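/- Let $n\ge 0$, let $u_0:\mathbb{R}^n\to\mathbb{R}^n$ be bounded and of class $C^1$, and let $\rho_0\in L^1_{loc}(\mathbb{R}^n)$ be bounded and nonnegative. Let $t_*(u_0)\in[0,\infty]$ be the supremum of the times $T$ such that the Cauchy problem $\partial_t u+(u,\nabla)u=0$, $u(0,\cdot)=u_0$, has a classical solution on $[0,T)\times\mathbb{R}^n$ (of class $C^1$, and bounded in $x$ at every time). Let $W^1,W^2$ be independent $n$-dimensional Brownian motions and, for constants $\sigma=(\sigma_1,\sigma_2)\neq(0,0)$, $\sigma_1,\sigma_2\ge 0$, consider the stochastic system $$dX=U\,dt+\sigma_1\,dW^1,\qquad dU=\sigma_2\,dW^2,$$ with initial distribution $P_0(dx,du)=\rho_0(x)\,\delta(u-u_0(x))\,dx\,du$ of $(X(0),U(0))$ (independent of $W^1,W^2$; its total mass need not be $1$). For $t>0$ write the joint distribution of $(X(t),U(t))$ as $P(t,x,du)\,dx$, where $P(t,x,\cdot)$ is a finite measure on $\mathbb{R}^n$ depending weakly continuously on $x$ (this determines it uniquely; it is $P(t,x,u)\,du$ when the distribution has a continuous density $P(t,x,u)$ with this continuity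 property), and put $$\rho_\sigma(t,x)=\int_{\mathbb{R}^n}P(t,x,du),\qquad u_\sigma(t,x)=\frac{\int_{\mathbb{R}^n}u\,P(t,x,du)}{\int_{\mathbb{R}^n}P(t,x,du)}\quad(\text{read as }0\text{ if the denominator is }0).$$ Let $\Omega=[0,t_*(u_0))\times\mathbb{R}^n$, and suppose that $\rho:\Omega\to\mathbb{R}$ and $\bar u:\Omega\to\mathbb{R}^n$ are $C^1$ and bounded on $\Omega$ and that $\rho_\sigma(t,x)\to\rho(t,x)$ and $u_\sigma(t,x)\to\bar u(t,x)$ as $|\sigma|\to 0$ for every $(t,x)\in\Omega$ with $t>0$. Then $(\rho,\bar u)$ solves the pressureless gas dynamics system at every point of $\Omega$ (with the one-sided time derivative at $t=0$): $$\partial_t\rho+\operatorname{div}_x(\rho\bar u)=0,\qquad \partial_t(\rho\bar u_i)+\operatorname{div}_x(\rho\bar u_i\,\bar u)=0\quad(i=1,\dots,n),$$ the second being $\partial_t(\rho\bar u)+\nabla_x\cdot(\rho\bar u\otimes\bar u)=0$. -/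

import Mathlib

open MeasureTheory ProbabilityTheory Filter Topology
open scoped NNReal ENNReal BoundedContinuousFunction

noncomputable section

namespace StochasticBurgers

/-- The Euclidean space `ℝⁿ`. -/
abbrev Sp (n : ℕ) := EuclideanSpace ℝ (Fin n)

/-! ### The Burgers equation and its time of smoothness -/

/-- The slab `[0, T) × ℝⁿ`, where `T ≤ ∞`. -/
def slab (n : ℕ) (T : ℝ≥0∞) : Set (ℝ × Sp n) :=
  {p | 0 ≤ p.1 ∧ ENNReal.ofReal p.1 < T}

/-- `u` is a classical solution on `[0, T) × ℝⁿ` of the Cauchy problem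
`∂ₜ u + (u, ∇) u = 0`, `u(0, ·) = u₀`, which stays of class `C¹` and bounded at every time. -/
structure IsClassicalBurgersSolution {n : ℕ} (u₀ : Sp n → Sp n) (T : ℝ≥0∞)
    (u : ℝ → Sp n → Sp n) : Prop where
  initial : u 0 = u₀
  smooth : ContDiffOn ℝ 1 (Function.uncurry u) (slab n T)
  bounded : ∀ t : ℝ, 0 ≤ t → ENNReal.ofReal t < T → ∃ C : ℝ, ∀ x, ‖u t x‖ ≤ C
  equation : ∀ t : ℝ, 0 < t → ENNReal.ofReal t < T → ∀ x : Sp n,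
    deriv (fun s => u s x) t + fderiv ℝ (u t) x (u t x) = 0

/-- `t_*(u₀) ∈ [0, ∞]`: the supremum of the times up to which the Burgers equation with initial
velocity `u₀` has a classical solution. -/
def smoothTime {n : ℕ} (u₀ : Sp n → Sp n) : ℝ≥0∞ :=
  sSup {T | ∃ u, IsClassicalBurgersSolution u₀ T u}

/-! ### The stochastic system -/

section Dynamics

variable {n : ℕ} {Ω : Type*} [MeasurableSpace Ω]

/-- `W 0` and `W 1` are two independent `n`-dimensional Brownian motions: their `2n` coordinates
are independent standard real Brownian motions. -/
structure IsBrownianPair (W : Fin 2 → Fin n → ℝ≥0 → Ω → ℝ) (Pr : Measure Ω) : Prop where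
  brownian : ∀ i k, IsBrownianReal (W i k) Pr
  indep : iIndepFun (fun (j : Fin 2 × Fin n) (ω : Ω) (t : ℝ≥0) => W j.1 j.2 t ω) Pr

/-- The value at time `t` of a vector process given by its coordinates. -/
def vec (B : Fin n → ℝ≥0 → Ω → ℝ) (t : ℝ≥0) (ω : Ω) : Sp n :=
  WithLp.toLp 2 (fun k => B k t ω)

/-- The solution of `dU = σ₂ dW²`, `U(0) = v`. -/
def velocity (W : Fin 2 → Fin n → ℝ≥0 → Ω → ℝ) (σ : ℝ≥0 × ℝ≥0) (v : Sp n)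
    (t : ℝ≥0) (ω : Ω) : Sp n :=
  v + (σ.2 : ℝ) • vec (W 1) t ω

/-- The solution of `dX = U dt + σ₁ dW¹`, `X(0) = x`, where `dU = σ₂ dW²`, `U(0) = v`. -/
def position (W : Fin 2 → Fin n → ℝ≥0 → Ω → ℝ) (σ : ℝ≥0 × ℝ≥0) (x v : Sp n)
    (t : ℝ≥0) (ω : Ω) : Sp n :=
  x + (∫ r in (0 : ℝ)..(t : ℝ), velocity W σ v r.toNNReal ω) + (σ.1 : ℝ) • vec (W 0) t ω

/-- The initial distribution `ρ₀(x) δ(u - u₀(x)) dx du` on the phase space. -/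
def initialLaw (ρ₀ : Sp n → ℝ) (u₀ : Sp n → Sp n) : Measure (Sp n × Sp n) :=
  (volume.withDensity (fun x => ENNReal.ofReal (ρ₀ x))).map (fun x => (x, u₀ x))

/-- The joint distribution of `(X(t), U(t))` when `(X(0), U(0))` has distribution `initialLaw ρ₀ u₀`
and is independent of the Brownian motions (the total mass need not be `1`). -/
def jointLaw (W : Fin 2 → Fin n → ℝ≥0 → Ω → ℝ) (Pr : Measure Ω) (ρ₀ : Sp n → ℝ)
    (u₀ : Sp n → Sp n) (σ : ℝ≥0 × ℝ≥0) (t : ℝ≥0) : Measure (Sp n × Sp n) :=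
  ((initialLaw ρ₀ u₀).prod Pr).map
    (fun q => (position W σ q.1.1 q.1.2 t q.2, velocity W σ q.1.2 t q.2))

end Dynamics

/-! ### The density in `x` of a law on the phase space, and its moments -/

section Density

variable {n : ℕ}

/-- `Q(dx, du) = κ(x)(du) dx`, with `x ↦ κ(x)` continuous for the weak topology of finite measures.
When `Q` has a nice density `P(x, u)`, then `κ(x)(du) = P(x, u) du`; measures in `u` are needed
because the law of `(X, U)` is singular in `u` when `σ₂ = 0`. -/
structure IsPhaseDensity (Q : Measure (Sp n × Sp n)) (κ : Sp n → FiniteMeasure (Sp n)) : Prop where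
  continuous : Continuous κ
  lintegral_eq : ∀ f : Sp n × Sp n → ℝ≥0∞, Measurable f →
    ∫⁻ p, f p ∂Q = ∫⁻ x, ∫⁻ u, f (x, u) ∂(κ x : Measure (Sp n))

/-- There is at most one such `κ`. -/
theorem IsPhaseDensity.unique {Q : Measure (Sp n × Sp n)} {κ κ' : Sp n → FiniteMeasure (Sp n)}
    (h : IsPhaseDensity Q κ) (h' : IsPhaseDensity Q κ') : κ = κ' := by
  have key : ∀ g : Sp n →ᵇ ℝ≥0,
      (fun x => ∫⁻ u, g u ∂(κ x : Measure (Sp n))) = fun x => ∫⁻ u, g u ∂(κ' x : Measure (Sp n)) := by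
    intro g
    have c := FiniteMeasure.continuous_iff_forall_continuous_lintegral.1 h.continuous g
    have c' := FiniteMeasure.continuous_iff_forall_continuous_lintegral.1 h'.continuous g
    refine Measure.eq_of_ae_eq (μ := (volume : Measure (Sp n))) ?_ c c'
    refine ae_eq_of_forall_setLIntegral_eq_of_sigmaFinite c.measurable c'.measurable ?_
    intro A hA _
    have hf : Measurable
        (fun p : Sp n × Sp n => A.indicator (fun _ => (1 : ℝ≥0∞)) p.1 * (g p.2 : ℝ≥0∞)) := by
      refine ((measurable_const.indicator hA).comp measurable_fst).mul ?_
      exact (measurable_coe_nnreal_ennreal.comp g.continuous.measurable).comp measurable_snd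
    have e := (h.lintegral_eq _ hf).symm.trans (h'.lintegral_eq _ hf)
    have hg : Measurable (fun u => (g u : ℝ≥0∞)) :=
      measurable_coe_nnreal_ennreal.comp g.continuous.measurable
    simp only [lintegral_const_mul _ hg] at e
    rw [← lintegral_indicator hA, ← lintegral_indicator hA]
    convert e using 2 <;> · ext x; by_cases hx : x ∈ A <;> simp [hx]
  funext x
  exact FiniteMeasure.ext_of_forall_lintegral_eq fun g => congrFun (key g) x

open scoped Classical in
/-- The density in `x` of a law on the phase space: the unique `κ` with `IsPhaseDensity Q κ`
(and `0` if there is none, which does not occur for the joint laws at times `t > 0` with `σ ≠ 0`). -/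
def phaseDensity (Q : Measure (Sp n × Sp n)) : Sp n → FiniteMeasure (Sp n) :=
  if h : ∃ κ, IsPhaseDensity Q κ then h.choose else 0

theorem IsPhaseDensity.phaseDensity_eq {Q : Measure (Sp n × Sp n)}
    {κ : Sp n → FiniteMeasure (Sp n)} (h : IsPhaseDensity Q κ) : phaseDensity Q = κ := by
  have hex : ∃ κ, IsPhaseDensity Q κ := ⟨κ, h⟩
  rw [phaseDensity, dif_pos hex]
  exact hex.choose_spec.unique h

/-- `∫ P(x, u) du`. -/
def massDensity (Q : Measure (Sp n × Sp n)) (x : Sp n) : ℝ :=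
  (phaseDensity Q x : Measure (Sp n)).real Set.univ

/-- `∫ u P(x, u) du / ∫ P(x, u) du`. -/
def meanVelocity (Q : Measure (Sp n × Sp n)) (x : Sp n) : Sp n :=
  (massDensity Q x)⁻¹ • ∫ u, u ∂(phaseDensity Q x : Measure (Sp n))

end Density

/-! ### The pressureless gas dynamics system -/

/-- The divergence of the vector field `F` at `x`. -/
def divergence {n : ℕ} (F : Sp n → Sp n) (x : Sp n) : ℝ :=
  ∑ k, fderiv ℝ (fun y => F y k) x (EuclideanSpace.single k 1)

/-- `∂ₜ ρ + div (ρ u) = 0` and `∂ₜ (ρ uᵢ) + div (ρ uᵢ u) = 0` for all `i`, in the classical sense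
at every point of `[0, T) × ℝⁿ` (at `t = 0` the time derivative is one-sided). -/
def SolvesPressurelessGas {n : ℕ} (T : ℝ≥0∞) (ρ : ℝ → Sp n → ℝ) (u : ℝ → Sp n → Sp n) : Prop :=
  ∀ (t : ℝ) (x : Sp n), (t, x) ∈ slab n T →
    derivWithin (fun s => ρ s x) (Set.Ici 0) t + divergence (fun y => ρ t y • u t y) x = 0 ∧
    ∀ i : Fin n, derivWithin (fun s => ρ s x * u s x i) (Set.Ici 0) t +
      divergence (fun y => (ρ t y * u t y i) • u t y) x = 0

end StochasticBurgers

end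

/-! The hypothesis gives limits along every approach `σ → 0`, so the ray `σ = (ε, 0)` suffices.
There a particle keeps its velocity `u₀ x` and sits at `Φ x + ε W(t)`, where `Φ x = x + t u₀ x` is
the free flow. With `ν = ρ₀ dx`, the mass and momentum densities are therefore the images under `Φ`
of `ν` and `u₀ ν`, convolved with a Gaussian of scale `ε` (`massDensity_jointLaw`,
`massDensity_mul_meanVelocity_jointLaw`).

As measures these convolutions tend to the images themselves. To identify the pointwise limits with
densities of the images, the convolutions must be locally bounded uniformly in `ε`. This is where `t
< t_*(u₀)` enters: a classical solution `u` is constant along characteristics, `u(t, Φ x) = u₀ x`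
(`apply_freeFlow`), so `y ↦ y - t u(t, y)` is a `C¹` left inverse of `Φ`, and the image of `ν` has a
locally bounded density (`locallyBoundedImage`). Hence `∫ φ ρ = ∫ φ(Φ) dν` and `∫ φ ρ ūᵢ = ∫ u₀ᵢ
φ(Φ) dν` for every continuous `φ` of compact support (`integral_mul_limit`).

Testing the first identity with `φ uᵢ` gives `ρ ūᵢ = ρ uᵢ` (`mul_eq_mul_of_integral`), whence `ρ ūᵢ
ūₖ` is the density of the image of `u₀ᵢ u₀ₖ ν`. Differentiating `∫ g φ(Φ) dν` in time, with `g = 1`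
and `g = u₀ᵢ`, yields both conservation laws weakly; they hold pointwise because all functions are
`C¹` (`balance_eq_zero`). -/

noncomputable section

namespace StochasticBurgers

/-! ### Gaussian density of a Brownian vector -/

theorem pi_gaussianReal_eq_withDensity (n : ℕ) {v : ℝ≥0} (hv : v ≠ 0) :
    Measure.pi (fun _ : Fin n => gaussianReal 0 v) =
      volume.withDensity (fun z => ENNReal.ofReal (∏ k, gaussianPDFReal 0 v (z k))) := by
  refine Measure.pi_eq fun s hs => ?_
  have hint : ∀ i, Integrable (gaussianPDFReal 0 v) (volume.restrict (s i)) :=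
    fun i => (integrable_gaussianPDFReal 0 v).restrict
  rw [withDensity_apply _ (MeasurableSet.univ_pi hs), volume_pi, Measure.restrict_pi_pi,
    ← ofReal_integral_eq_lintegral_ofReal
      (Integrable.fintype_prod (f := fun _ => gaussianPDFReal 0 v) hint)
      (Eventually.of_forall fun z => Finset.prod_nonneg fun i _ => gaussianPDFReal_nonneg _ _ _),
    integral_fintype_prod_eq_prod (f := fun _ => gaussianPDFReal 0 v),
    ENNReal.ofReal_prod_of_nonneg (fun i _ => integral_nonneg fun x => gaussianPDFReal_nonneg _ _ _)]
  refine Finset.prod_congr rfl fun i _ => ?_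
  rw [gaussianReal_apply_eq_integral 0 hv]

/-- The exponential series gives `(1 + r) ^ m ≤ m! exp (1 + r)`; completing the square in the
exponent leaves `(r - v) ^ 2 / (2 * v) ≥ 0`. -/
theorem exp_neg_sq_mul_pow_le {v : ℝ} (hv : 0 < v) (m : ℕ) {r : ℝ} (hr : 0 ≤ r) :
    Real.exp (-(r ^ 2) / (2 * v)) * (1 + r) ^ m ≤ m.factorial * Real.exp (1 + v / 2) := by
  have h1 : (1 + r) ^ m ≤ m.factorial * Real.exp (1 + r) := by
    have := Real.pow_div_factorial_le_exp (1 + r) (by positivity) m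
    rwa [div_le_iff₀ (by positivity), mul_comm] at this
  have h2 : -(r ^ 2) / (2 * v) + (1 + r) ≤ 1 + v / 2 := by
    have : 1 + v / 2 - (-(r ^ 2) / (2 * v) + (1 + r)) = (r - v) ^ 2 / (2 * v) := by
      field_simp; ring
    have h3 : 0 ≤ (r - v) ^ 2 / (2 * v) := by positivity
    linarith
  calc _ ≤ Real.exp (-(r ^ 2) / (2 * v)) * (m.factorial * Real.exp (1 + r)) := by gcongr
    _ = m.factorial * Real.exp (-(r ^ 2) / (2 * v) + (1 + r)) := by rw [Real.exp_add _ (1 + r)]; ring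
    _ ≤ _ := by gcongr

/-- A continuous probability density with a polynomial decay of order `2 (n + 1)`. -/
structure IsDecayingDensity {n : ℕ} (p : Sp n → ℝ) : Prop where
  continuous : Continuous p
  nonneg : ∀ z, 0 ≤ p z
  lintegral_eq_one : ∫⁻ z, ENNReal.ofReal (p z) = 1
  decay : ∃ A, ∀ z, p z * (1 + ‖z‖) ^ (2 * (n + 1)) ≤ A

theorem IsBrownianPair.aemeasurable_vec {n : ℕ} {Ω : Type*} [MeasurableSpace Ω] {Pr : Measure Ω}
    {W : Fin 2 → Fin n → ℝ≥0 → Ω → ℝ} (hW : IsBrownianPair W Pr) (i : Fin 2) (t : ℝ≥0) :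
    AEMeasurable (vec (W i) t) Pr :=
  (PiLp.volume_preserving_toLp (Fin n)).measurable.comp_aemeasurable
    (aemeasurable_pi_lambda _ fun k => (hW.brownian i k).aemeasurable t)

theorem IsBrownianPair.exists_density {n : ℕ} {Ω : Type*} [MeasurableSpace Ω] {Pr : Measure Ω}
    [IsProbabilityMeasure Pr] {W : Fin 2 → Fin n → ℝ≥0 → Ω → ℝ} (hW : IsBrownianPair W Pr)
    (i : Fin 2) {t : ℝ≥0} (ht : 0 < t) :
    ∃ p : Sp n → ℝ, IsDecayingDensity p ∧
      Pr.map (vec (W i) t) = volume.withDensity (fun z => ENNReal.ofReal (p z)) := by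
  have hmeas : ∀ k, AEMeasurable (W i k t) Pr := fun k => (hW.brownian i k).aemeasurable t
  have hind : iIndepFun (fun k : Fin n => W i k t) Pr :=
    (hW.indep.precomp (g := fun k : Fin n => (i, k)) (fun a b h => (Prod.mk.inj h).2)).comp
      (fun _ f => f t) (fun _ => measurable_pi_apply t)
  have hlaw := (iIndepFun_iff_map_fun_eq_pi_map hmeas).1 hind
  simp_rw [fun k => ((hW.brownian i k).hasLaw_eval t).map_eq] at hlaw
  rw [pi_gaussianReal_eq_withDensity n ht.ne'] at hlaw
  have hmp := PiLp.volume_preserving_toLp (Fin n)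
  have hc : Continuous fun z : Sp n => ∏ k, gaussianPDFReal 0 t (z k) := by
    unfold gaussianPDFReal; fun_prop
  have hmap : Pr.map (vec (W i) t) =
      volume.withDensity (fun z : Sp n => ENNReal.ofReal (∏ k, gaussianPDFReal 0 t (z k))) := by
    have : Pr.map (vec (W i) t) =
        (Pr.map (fun ω k => W i k t ω)).map (WithLp.toLp 2) :=
      (AEMeasurable.map_map_of_aemeasurable hmp.measurable.aemeasurable
        (aemeasurable_pi_lambda _ hmeas)).symm
    rw [this, hlaw]
    ext s hs
    rw [Measure.map_apply hmp.measurable hs, withDensity_apply _ (hmp.measurable hs),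
      withDensity_apply _ hs]
    exact hmp.setLIntegral_comp_preimage hs (ENNReal.measurable_ofReal.comp hc.measurable)
  have : IsProbabilityMeasure (Pr.map (vec (W i) t)) :=
    Measure.isProbabilityMeasure_map (hW.aemeasurable_vec i t)
  refine ⟨_, ⟨hc, fun z => Finset.prod_nonneg fun _ _ => gaussianPDFReal_nonneg _ _ _, ?_, ?_⟩, hmap⟩
  · have h1 := measure_univ (μ := Pr.map (vec (W i) t))
    rwa [hmap, withDensity_apply _ MeasurableSet.univ, Measure.restrict_univ] at h1
  · refine ⟨(∏ _k : Fin n, (√(2 * Real.pi * t))⁻¹) *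
      ((2 * (n + 1)).factorial * Real.exp (1 + t / 2)), fun z => ?_⟩
    have hp : ∏ k, gaussianPDFReal 0 t (z k) =
        (∏ _k : Fin n, (√(2 * Real.pi * t))⁻¹) * Real.exp (-(‖z‖ ^ 2) / (2 * t)) := by
      simp only [gaussianPDFReal, sub_zero]
      rw [Finset.prod_mul_distrib, ← Real.exp_sum, ← Finset.sum_div, Finset.sum_neg_distrib,
        EuclideanSpace.norm_sq_eq]
      simp
    rw [hp, mul_assoc]
    exact mul_le_mul_of_nonneg_left (exp_neg_sq_mul_pow_le (by exact_mod_cast ht) _ (norm_nonneg z))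
      (Finset.prod_nonneg fun _ _ => by positivity)

/-! ### Polynomial weights and rescaled densities -/

/-- An integrable polynomially decaying weight. -/
def weight {n : ℕ} (x : Sp n) : ℝ := ((1 + ‖x‖) ^ (n + 1))⁻¹

theorem weight_pos {n : ℕ} (x : Sp n) : 0 < weight x := by unfold weight; positivity

theorem integrable_weight {n : ℕ} : Integrable (weight : Sp n → ℝ) := by
  have h := integrable_one_add_norm (E := Sp n) (μ := volume) (r := (n + 1 : ℕ)) (by simp)
  refine h.congr (Eventually.of_forall fun x => ?_)
  simp only [weight]
  rw [Real.rpow_neg (by positivity), Real.rpow_natCast]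

/-- Since `1 + ‖x‖ ≤ (1 + b) * (1 + ‖z‖)`, a displacement by at most `b` costs only a constant
factor in the weight. -/
theorem weight_le {n : ℕ} {b : ℝ} (hb : 0 ≤ b) {x z : Sp n} (h : ‖x‖ ≤ ‖z‖ + b) :
    weight z ≤ (1 + b) ^ (n + 1) * weight x := by
  unfold weight
  rw [← div_eq_mul_inv, le_div_iff₀ (by positivity), inv_mul_le_iff₀ (by positivity), ← mul_pow]
  refine pow_le_pow_left₀ (by positivity) ?_ _
  nlinarith [norm_nonneg z, mul_nonneg (norm_nonneg z) hb]

/-- The density of `ε • Z` when `Z` has density `p`. -/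
def dilate {n : ℕ} (p : Sp n → ℝ) (ε : ℝ) (z : Sp n) : ℝ := (ε ^ n)⁻¹ * p (ε⁻¹ • z)

theorem lintegral_mul_dilate {n : ℕ} {p : Sp n → ℝ} {ε : ℝ} (hε : 0 < ε)
    (f : Sp n → ℝ≥0∞) (a : Sp n) :
    ∫⁻ y, f y * ENNReal.ofReal (dilate p ε (y - a)) =
      ∫⁻ z, f (a + ε • z) * ENNReal.ofReal (p z) := by
  have h1 : ∫⁻ y, f y * ENNReal.ofReal (dilate p ε (y - a)) =
      ∫⁻ y, f (a + y) * ENNReal.ofReal (dilate p ε y) := by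
    rw [← lintegral_add_left_eq_self _ a]
    simp
  have h2 := lintegral_map_equiv (μ := (volume : Measure (Sp n)))
    (fun y => f (a + y) * ENNReal.ofReal (dilate p ε y))
    (Homeomorph.smulOfNeZero ε hε.ne').toMeasurableEquiv
  have h3 : (volume : Measure (Sp n)).map (Homeomorph.smulOfNeZero ε hε.ne').toMeasurableEquiv =
      ENNReal.ofReal (ε ^ n)⁻¹ • volume := by
    have := Measure.map_addHaar_smul (volume : Measure (Sp n)) hε.ne'
    rw [abs_of_pos (by positivity), finrank_euclideanSpace_fin] at this
    exact this
  rw [h3, lintegral_smul_measure] at h2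
  have hpos : 0 < (ε ^ n)⁻¹ := by positivity
  have hne : ENNReal.ofReal (ε ^ n)⁻¹ ≠ 0 := by simpa using hpos
  have h4 : ∫⁻ z, f (a + ε • z) * ENNReal.ofReal (dilate p ε (ε • z)) =
      ENNReal.ofReal (ε ^ n)⁻¹ * ∫⁻ z, f (a + ε • z) * ENNReal.ofReal (p z) := by
    rw [← lintegral_const_mul' _ _ ENNReal.ofReal_ne_top]
    refine lintegral_congr fun z => ?_
    rw [dilate, smul_smul, inv_mul_cancel₀ hε.ne', one_smul, ENNReal.ofReal_mul hpos.le]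
    ring
  rw [h1]
  refine (ENNReal.mul_right_inj hne ENNReal.ofReal_ne_top).1 ?_
  rw [← h4]
  exact h2

theorem integral_mul_dilate {n : ℕ} {p : Sp n → ℝ} {ε : ℝ} (hε : 0 < ε)
    (f : Sp n → ℝ) (a : Sp n) :
    ∫ y, f y * dilate p ε (y - a) = ∫ z, f (a + ε • z) * p z := by
  have h1 : ∫ y, f y * dilate p ε (y - a) = ∫ y, f (a + y) * dilate p ε y := by
    rw [← integral_add_left_eq_self _ a]
    simp
  have h2 := Measure.integral_comp_smul (volume : Measure (Sp n))
    (fun y => f (a + y) * dilate p ε y) ε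
  have h4 : ∫ z, f (a + ε • z) * dilate p ε (ε • z) =
      (ε ^ n)⁻¹ * ∫ z, f (a + ε • z) * p z := by
    rw [← integral_const_mul]
    refine integral_congr_ae (Eventually.of_forall fun z => ?_)
    simp only [dilate, smul_smul, inv_mul_cancel₀ hε.ne', one_smul]
    ring
  rw [h4, finrank_euclideanSpace_fin, abs_of_pos (by positivity), smul_eq_mul] at h2
  rw [h1]
  exact (mul_left_cancel₀ (by positivity) h2).symm

namespace IsDecayingDensity

variable {n : ℕ} {p : Sp n → ℝ}

theorem dilate_nonneg (hp : IsDecayingDensity p) {ε : ℝ} (hε : 0 ≤ ε) (z : Sp n) :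
    0 ≤ dilate p ε z := mul_nonneg (by positivity) (hp.nonneg _)

theorem continuous_dilate (hp : IsDecayingDensity p) (ε : ℝ) : Continuous (dilate p ε) :=
  continuous_const.mul (hp.continuous.comp (continuous_const_smul _))

/-- Half of the exponent `2 * (n + 1)` pays for an integrable weight; the other half absorbs the
factor `(1 + ‖z‖) ^ (n + 1)` that arises when weights are compared across the noise displacement `ε
• z`. -/
theorem exists_mul_pow_le (hp : IsDecayingDensity p) :
    ∃ A, 0 ≤ A ∧ (∀ z, p z * (1 + ‖z‖) ^ (n + 1) ≤ A * weight z) ∧ ∀ z, p z ≤ A * weight z := by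
  obtain ⟨A, hA⟩ := hp.decay
  have h1 : ∀ z, p z * (1 + ‖z‖) ^ (n + 1) ≤ A * weight z := fun z => by
    rw [weight, ← div_eq_mul_inv, le_div_iff₀ (by positivity)]
    have := hA z
    rwa [two_mul, pow_add, ← mul_assoc] at this
  refine ⟨A, (mul_nonneg (hp.nonneg 0) (by positivity)).trans (hA 0), h1, fun z => ?_⟩
  refine le_trans (le_mul_of_one_le_right (hp.nonneg z) ?_) (h1 z)
  exact one_le_pow₀ (by linarith [norm_nonneg z])

theorem dilate_le (hp : IsDecayingDensity p) {ε : ℝ} (hε : 0 < ε) (hε1 : ε ≤ 1) :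
    ∃ B, 0 ≤ B ∧ ∀ z, dilate p ε z ≤ B * weight z := by
  obtain ⟨A, hA0, -, hA⟩ := hp.exists_mul_pow_le
  refine ⟨(ε ^ n)⁻¹ * A, by positivity, fun z => ?_⟩
  rw [dilate, mul_assoc]
  refine mul_le_mul_of_nonneg_left ((hA _).trans (mul_le_mul_of_nonneg_left ?_ hA0)) (by positivity)
  have : ‖z‖ ≤ ‖ε⁻¹ • z‖ + 0 := by
    rw [norm_smul, norm_inv, Real.norm_of_nonneg hε.le, add_zero, inv_mul_eq_div]
    exact le_div_self (norm_nonneg _) hε hε1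
  simpa using weight_le le_rfl this

/-- Away from the unit ball the decay contributes `ε ^ (n + 1)`, which beats the normalization `ε ^
(-n)`; so `B`, unlike in `dilate_le`, does not depend on `ε`. -/
theorem dilate_le_of_one_le_norm (hp : IsDecayingDensity p) :
    ∃ B, 0 ≤ B ∧ ∀ ε, 0 < ε → ε ≤ 1 → ∀ z, 1 ≤ ‖z‖ → dilate p ε z ≤ B * weight z := by
  obtain ⟨A, hA0, -, hA⟩ := hp.exists_mul_pow_le
  refine ⟨A * 2 ^ (n + 1), by positivity, fun ε hε hε1 z hz => ?_⟩
  have h1 : weight (ε⁻¹ • z) ≤ (2 * ε) ^ (n + 1) * weight z := by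
    unfold weight
    rw [← div_eq_mul_inv, le_div_iff₀ (by positivity), inv_mul_le_iff₀ (by positivity), ← mul_pow]
    refine pow_le_pow_left₀ (by positivity) ?_ _
    rw [norm_smul, norm_inv, Real.norm_of_nonneg hε.le]
    have : (1 + ε⁻¹ * ‖z‖) * (2 * ε) = 2 * ε + 2 * ‖z‖ := by field_simp
    linarith
  calc dilate p ε z ≤ (ε ^ n)⁻¹ * (A * ((2 * ε) ^ (n + 1) * weight z)) :=
        mul_le_mul_of_nonneg_left ((hA _).trans (mul_le_mul_of_nonneg_left h1 hA0)) (by positivity)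
    _ = (A * 2 ^ (n + 1) * weight z) * ε := by rw [mul_pow, pow_succ ε]; field_simp
    _ ≤ (A * 2 ^ (n + 1) * weight z) * 1 := by
        have := weight_pos z
        gcongr
    _ = _ := mul_one _

theorem integral_eq_one (hp : IsDecayingDensity p) : ∫ z, p z = 1 := by
  rw [integral_eq_lintegral_of_nonneg_ae (Eventually.of_forall hp.nonneg)
    hp.continuous.aestronglyMeasurable, hp.lintegral_eq_one, ENNReal.toReal_one]

theorem lintegral_dilate (hp : IsDecayingDensity p) {ε : ℝ} (hε : 0 < ε) (y : Sp n) :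
    ∫⁻ w, ENNReal.ofReal (dilate p ε (y - w)) = 1 := by
  have h1 := lintegral_sub_left_eq_self (μ := (volume : Measure (Sp n)))
    (fun w => ENNReal.ofReal (dilate p ε w)) y
  have h2 := lintegral_mul_dilate (p := p) hε (fun _ => 1) 0
  simp only [one_mul, sub_zero, hp.lintegral_eq_one] at h2
  rw [h1, h2]

end IsDecayingDensity

/-! ### Smearing a transported measure and letting the scale tend to zero -/

/-- `ν` has a bounded density and `Φ` is a continuous map at bounded distance from the identity. -/
structure IsBoundedTransport {n : ℕ} (ν : Measure (Sp n)) (Φ : Sp n → Sp n) : Prop where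
  le : ∃ C : ℝ≥0, ν ≤ C • volume
  continuous : Continuous Φ
  near : ∃ b, 0 ≤ b ∧ ∀ x, ‖Φ x - x‖ ≤ b

/-- The smearing at scale `ε` of the image under `Φ` of the measure `g ν`. -/
def smear {n : ℕ} (p : Sp n → ℝ) (ν : Measure (Sp n)) (Φ : Sp n → Sp n) (g : Sp n → ℝ) (ε : ℝ)
    (y : Sp n) : ℝ :=
  ∫ x, g x * dilate p ε (y - Φ x) ∂ν

namespace IsBoundedTransport

variable {n : ℕ} {p : Sp n → ℝ} {ν : Measure (Sp n)} {Φ : Sp n → Sp n}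

theorem sigmaFinite (h : IsBoundedTransport ν Φ) : SigmaFinite ν := by
  obtain ⟨C, hC⟩ := h.le
  exact Measure.sigmaFinite_of_le _ hC

theorem integrable (h : IsBoundedTransport ν Φ) {f : Sp n → ℝ} (hf : Integrable f) :
    Integrable f ν := by
  obtain ⟨C, hC⟩ := h.le
  exact (hf.smul_measure_nnreal (c := C)).mono_measure hC

theorem weight_sub_le (h : IsBoundedTransport ν Φ) (R : ℝ) :
    ∃ D, 0 ≤ D ∧ ∀ y, ‖y‖ ≤ R → ∀ x, weight (y - Φ x) ≤ D * weight x := by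
  obtain ⟨b, hb0, hb⟩ := h.near
  refine ⟨(1 + (b + |R|)) ^ (n + 1), by positivity, fun y hy x => weight_le (by positivity) ?_⟩
  have h1 : ‖x‖ ≤ ‖y - Φ x‖ + ‖y‖ + ‖Φ x - x‖ := by
    have : x = y - (y - Φ x) - (Φ x - x) := by abel
    calc ‖x‖ = ‖y - (y - Φ x) - (Φ x - x)‖ := by rw [← this]
      _ ≤ ‖y‖ + ‖y - Φ x‖ + ‖Φ x - x‖ := (norm_sub_le _ _).trans (by gcongr; exact norm_sub_le _ _)
      _ = _ := by ring
  linarith [hb x, le_abs_self R]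

theorem dilate_sub_le (h : IsBoundedTransport ν Φ) (hp : IsDecayingDensity p) {ε : ℝ} (hε : 0 < ε)
    (hε1 : ε ≤ 1) (R : ℝ) :
    ∃ D, 0 ≤ D ∧ ∀ y, ‖y‖ ≤ R → ∀ x, dilate p ε (y - Φ x) ≤ D * weight x := by
  obtain ⟨B, hB0, hB⟩ := hp.dilate_le hε hε1
  obtain ⟨D, hD0, hD⟩ := h.weight_sub_le R
  refine ⟨B * D, by positivity, fun y hy x => (hB _).trans ?_⟩
  rw [mul_assoc]
  exact mul_le_mul_of_nonneg_left (hD y hy x) hB0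

theorem integrable_dilate (h : IsBoundedTransport ν Φ) (hp : IsDecayingDensity p) {ε : ℝ}
    (hε : 0 < ε) (hε1 : ε ≤ 1) (y : Sp n) : Integrable (fun x => dilate p ε (y - Φ x)) ν := by
  obtain ⟨D, -, hD⟩ := h.dilate_sub_le hp hε hε1 ‖y‖
  refine Integrable.mono' ((h.integrable integrable_weight).const_mul D) ?_
    (Eventually.of_forall fun x => ?_)
  · exact ((hp.continuous_dilate ε).comp
      (continuous_const.sub h.continuous)).aestronglyMeasurable
  · rw [Real.norm_of_nonneg (hp.dilate_nonneg hε.le _)]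
    exact hD y le_rfl x

/-- Split at `‖y - Φ x‖ = 1`. The near part lives on `ball y 1 ⊆ ball 0 (R + 1)`, where the image
has density at most `C'` and the kernel has mass one. The far part is dominated by the integrable
weight, uniformly in `ε`. -/
theorem integral_dilate_bounded (h : IsBoundedTransport ν Φ) (hp : IsDecayingDensity p) {R : ℝ}
    {C' : ℝ≥0} (hC' : (ν.map Φ).restrict (Metric.ball 0 (R + 1)) ≤ C' • volume) :
    ∃ M, 0 ≤ M ∧ ∀ ε, 0 < ε → ε ≤ 1 → ∀ y, ‖y‖ ≤ R → ∫ x, dilate p ε (y - Φ x) ∂ν ≤ M := by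
  obtain ⟨B, hB0, hB⟩ := hp.dilate_le_of_one_le_norm
  obtain ⟨D, hD0, hD⟩ := h.weight_sub_le R
  have hwi : Integrable (fun x : Sp n => B * D * weight x) ν :=
    (h.integrable integrable_weight).const_mul _
  have hw0 : ∀ x : Sp n, 0 ≤ B * D * weight x := fun x =>
    mul_nonneg (by positivity) (weight_pos x).le
  refine ⟨C' + ∫ x, B * D * weight x ∂ν, add_nonneg C'.2 (integral_nonneg hw0),
    fun ε hε hε1 y hy => ?_⟩
  have hint := h.integrable_dilate hp hε hε1 y
  have hs : MeasurableSet (Φ ⁻¹' Metric.ball y 1) :=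
    (Metric.isOpen_ball.preimage h.continuous).measurableSet
  rw [← integral_add_compl hs hint]
  refine add_le_add ?_ ?_
  · rw [integral_eq_lintegral_of_nonneg_ae (Eventually.of_forall fun x => hp.dilate_nonneg hε.le _)
      hint.aestronglyMeasurable.restrict]
    refine ENNReal.toReal_le_of_le_ofReal C'.2 ?_
    have hm : Measurable fun w => ENNReal.ofReal (dilate p ε (y - w)) :=
      ENNReal.measurable_ofReal.comp ((hp.continuous_dilate ε).comp
        (continuous_const.sub continuous_id)).measurable
    calc ∫⁻ x in Φ ⁻¹' Metric.ball y 1, ENNReal.ofReal (dilate p ε (y - Φ x)) ∂ν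
        = ∫⁻ w in Metric.ball y 1, ENNReal.ofReal (dilate p ε (y - w)) ∂(ν.map Φ) :=
          (setLIntegral_map Metric.isOpen_ball.measurableSet hm h.continuous.measurable).symm
      _ ≤ ∫⁻ w in Metric.ball 0 (R + 1), ENNReal.ofReal (dilate p ε (y - w)) ∂(ν.map Φ) :=
          lintegral_mono_set (Metric.ball_subset_ball' (by
            rw [dist_zero_right]; linarith))
      _ ≤ ∫⁻ w, ENNReal.ofReal (dilate p ε (y - w)) ∂(C' • volume) :=
          lintegral_mono' hC' le_rfl
      _ = ENNReal.ofReal C' := by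
          rw [lintegral_smul_measure, hp.lintegral_dilate hε]
          simp [ENNReal.smul_def]
  · refine (setIntegral_mono_on hint.integrableOn hwi.integrableOn hs.compl fun x hx => ?_).trans
      (setIntegral_le_integral hwi (Eventually.of_forall hw0))
    have hx1 : 1 ≤ ‖y - Φ x‖ := by
      rw [← dist_eq_norm, dist_comm]; simpa using hx
    refine (hB ε hε hε1 _ hx1).trans ?_
    rw [mul_assoc]
    exact mul_le_mul_of_nonneg_left (hD y hy x) hB0

theorem abs_smear_le (h : IsBoundedTransport ν Φ) (hp : IsDecayingDensity p) {g : Sp n → ℝ}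
    {G : ℝ} (hG : ∀ x, |g x| ≤ G) {ε : ℝ} (hε : 0 < ε) (hε1 : ε ≤ 1) (y : Sp n) :
    |smear p ν Φ g ε y| ≤ G * ∫ x, dilate p ε (y - Φ x) ∂ν := by
  rw [smear, ← integral_const_mul, ← Real.norm_eq_abs]
  refine norm_integral_le_of_norm_le ((h.integrable_dilate hp hε hε1 y).const_mul G)
    (Eventually.of_forall fun x => ?_)
  rw [norm_mul, Real.norm_of_nonneg (hp.dilate_nonneg hε.le _), Real.norm_eq_abs]
  exact mul_le_mul_of_nonneg_right (hG x) (hp.dilate_nonneg hε.le _)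

theorem continuous_smear (h : IsBoundedTransport ν Φ) (hp : IsDecayingDensity p) {g : Sp n → ℝ}
    (hg : Continuous g) {G : ℝ} (hG : ∀ x, |g x| ≤ G) {ε : ℝ} (hε : 0 < ε) (hε1 : ε ≤ 1) :
    Continuous (smear p ν Φ g ε) := by
  refine continuous_iff_continuousAt.2 fun y₀ => ?_
  obtain ⟨D, hD0, hD⟩ := h.dilate_sub_le hp hε hε1 (‖y₀‖ + 1)
  refine continuousAt_of_dominated (bound := fun x => G * (D * weight x))
    (Eventually.of_forall fun y => ?_) ?_
    (((h.integrable integrable_weight).const_mul D).const_mul G)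
    (Eventually.of_forall fun x => ?_)
  · exact (hg.mul ((hp.continuous_dilate ε).comp
      (continuous_const.sub h.continuous))).aestronglyMeasurable
  · filter_upwards [Metric.ball_mem_nhds y₀ one_pos] with y hy
    have hy' : ‖y‖ ≤ ‖y₀‖ + 1 := by
      have := norm_sub_norm_le y y₀
      rw [Metric.mem_ball, dist_eq_norm] at hy
      linarith
    refine Eventually.of_forall fun x => ?_
    rw [norm_mul, Real.norm_of_nonneg (hp.dilate_nonneg hε.le _), Real.norm_eq_abs]
    exact mul_le_mul (hG x) (hD y hy' x) (hp.dilate_nonneg hε.le _) ((abs_nonneg _).trans (hG x))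
  · exact (continuous_const.mul ((hp.continuous_dilate ε).comp
      (continuous_id.sub continuous_const))).continuousAt

end IsBoundedTransport

/-- The image under `Φ` of `ν` has a locally bounded density. -/
def LocallyBoundedImage {n : ℕ} (ν : Measure (Sp n)) (Φ : Sp n → Sp n) : Prop :=
  ∀ R : ℝ, ∃ C : ℝ≥0, (ν.map Φ).restrict (Metric.ball 0 R) ≤ C • volume

namespace IsBoundedTransport

variable {n : ℕ} {p : Sp n → ℝ} {ν : Measure (Sp n)} {Φ : Sp n → Sp n} {g φ : Sp n → ℝ} {G : ℝ}

/-- Fubini, then the substitution `y = Φ x + ε • z` in the inner integral. -/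
theorem integral_mul_smear (h : IsBoundedTransport ν Φ) (hp : IsDecayingDensity p)
    (hg : Continuous g) (hG : ∀ x, |g x| ≤ G) (hφ : Continuous φ) (hφc : HasCompactSupport φ)
    {ε : ℝ} (hε : 0 < ε) (hε1 : ε ≤ 1) :
    ∫ y, φ y * smear p ν Φ g ε y = ∫ x, (∫ z, g x * φ (Φ x + ε • z) * p z) ∂ν := by
  have := h.sigmaFinite
  obtain ⟨R, hR⟩ := hφc.isCompact.isBounded.subset_closedBall 0
  obtain ⟨D, hD0, hD⟩ := h.dilate_sub_le hp hε hε1 R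
  have hG0 : 0 ≤ G := (abs_nonneg _).trans (hG 0)
  have hint : Integrable (Function.uncurry fun y x => φ y * (g x * dilate p ε (y - Φ x)))
      (volume.prod ν) := by
    have hb : Integrable (fun q : Sp n × Sp n => ‖φ q.1‖ * (G * D * weight q.2))
        (volume.prod ν) :=
      ((hφ.integrable_of_hasCompactSupport hφc).norm).mul_prod
        ((h.integrable integrable_weight).const_mul (G * D))
    have hc : Continuous (Function.uncurry fun y x => φ y * (g x * dilate p ε (y - Φ x))) :=
      (hφ.comp continuous_fst).mul ((hg.comp continuous_snd).mul
        ((hp.continuous_dilate ε).comp (continuous_fst.sub (h.continuous.comp continuous_snd))))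
    refine hb.mono' hc.aestronglyMeasurable (Eventually.of_forall fun q => ?_)
    rcases eq_or_ne (φ q.1) 0 with h0 | h0
    · simp [Function.uncurry, h0]
    · have hq : ‖q.1‖ ≤ R := by
        simpa using hR (subset_tsupport _ h0)
      simp only [Function.uncurry, norm_mul]
      rw [Real.norm_of_nonneg (hp.dilate_nonneg hε.le _), mul_assoc G]
      refine mul_le_mul_of_nonneg_left ?_ (norm_nonneg _)
      exact mul_le_mul (hG _) (hD _ hq _) (hp.dilate_nonneg hε.le _) hG0
  simp only [smear, ← integral_const_mul]
  rw [integral_integral_swap hint]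
  refine integral_congr_ae (Eventually.of_forall fun x => ?_)
  refine Eq.trans ?_ (integral_mul_dilate (p := p) hε (fun y => g x * φ y) (Φ x))
  refine integral_congr_ae (Eventually.of_forall fun y => ?_)
  simp only
  ring

theorem integrable_comp (h : IsBoundedTransport ν Φ) (hg : Continuous g)
    (hφ : Continuous φ) (hφc : HasCompactSupport φ) : Integrable (fun x => g x * φ (Φ x)) ν := by
  obtain ⟨C, hC⟩ := h.le
  obtain ⟨b, hb0, hb⟩ := h.near
  obtain ⟨R, hR⟩ := hφc.isCompact.isBounded.subset_closedBall 0
  refine h.integrable ?_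
  refine (hg.mul (hφ.comp h.continuous)).integrable_of_hasCompactSupport ?_
  refine HasCompactSupport.intro (isCompact_closedBall (0 : Sp n) (R + b)) fun x hx => ?_
  have h0 : φ (Φ x) = 0 := by
    by_contra h0
    have h1 : ‖Φ x‖ ≤ R := by simpa using hR (subset_tsupport _ h0)
    apply hx
    rw [mem_closedBall_zero_iff]
    have h2 := norm_sub_norm_le x (Φ x)
    have h3 := hb x
    rw [norm_sub_rev] at h3
    linarith
  simp [h0]

/-- Dominated convergence on `ν.prod volume`. As `ν` may be infinite, the majorant needs decay in
both variables: the compact support of `φ` yields decay in `x`, and the density `p` pays for the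
loss caused by `z`. -/
theorem tendsto_integral_mul_smear (h : IsBoundedTransport ν Φ) (hp : IsDecayingDensity p)
    (hg : Continuous g) (hG : ∀ x, |g x| ≤ G) (hφ : Continuous φ) (hφc : HasCompactSupport φ) :
    Tendsto (fun ε => ∫ y, φ y * smear p ν Φ g ε y) (𝓝[>] 0) (𝓝 (∫ x, g x * φ (Φ x) ∂ν)) := by
  have := h.sigmaFinite
  have hG0 : 0 ≤ G := (abs_nonneg _).trans (hG 0)
  obtain ⟨b, hb0, hb⟩ := h.near
  obtain ⟨A, hA0, hA, -⟩ := hp.exists_mul_pow_le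
  obtain ⟨R, hR⟩ := hφc.isCompact.isBounded.subset_closedBall 0
  obtain ⟨S, hS⟩ := hφc.exists_bound_of_continuous hφ
  have hS0 : 0 ≤ S := (norm_nonneg _).trans (hS 0)
  -- the compactly supported `φ` is controlled by the weight
  obtain ⟨M, hM0, hM⟩ : ∃ M, 0 ≤ M ∧ ∀ y, ‖φ y‖ ≤ M * weight y := by
    refine ⟨S * (1 + |R|) ^ (n + 1), by positivity, fun y => ?_⟩
    rcases eq_or_ne (φ y) 0 with h0 | h0
    · rw [h0, norm_zero]
      exact mul_nonneg (by positivity) (weight_pos y).le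
    · have hy : ‖y‖ ≤ R := by simpa using hR (subset_tsupport _ h0)
      have h1 := weight_le (abs_nonneg R) (x := y) (z := 0) (by
        rw [norm_zero, zero_add]; exact hy.trans (le_abs_self R))
      have h2 : weight (0 : Sp n) = 1 := by simp [weight]
      rw [h2] at h1
      rw [mul_assoc]
      exact (hS y).trans (le_mul_of_one_le_right hS0 h1)
  have hcont : ∀ ε : ℝ, Continuous fun q : Sp n × Sp n => g q.1 * φ (Φ q.1 + ε • q.2) * p q.2 := by
    intro ε
    exact ((hg.comp continuous_fst).mul (hφ.comp ((h.continuous.comp continuous_fst).add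
      (continuous_snd.const_smul ε)))).mul (hp.continuous.comp continuous_snd)
  have hbd : ∀ ε : ℝ, 0 ≤ ε → ε ≤ 1 → ∀ q : Sp n × Sp n,
      ‖g q.1 * φ (Φ q.1 + ε • q.2) * p q.2‖ ≤
        G * M * (1 + b) ^ (n + 1) * weight q.1 * (A * weight q.2) := by
    intro ε hε hε1 q
    have h1 : weight (Φ q.1 + ε • q.2) ≤ (1 + (b + ‖q.2‖)) ^ (n + 1) * weight q.1 := by
      refine weight_le (by positivity) ?_
      have h2 : q.1 = (Φ q.1 + ε • q.2) - ε • q.2 - (Φ q.1 - q.1) := by abel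
      calc ‖q.1‖ = ‖(Φ q.1 + ε • q.2) - ε • q.2 - (Φ q.1 - q.1)‖ := by rw [← h2]
        _ ≤ ‖Φ q.1 + ε • q.2‖ + ‖ε • q.2‖ + ‖Φ q.1 - q.1‖ :=
          (norm_sub_le _ _).trans (by gcongr; exact norm_sub_le _ _)
        _ ≤ ‖Φ q.1 + ε • q.2‖ + ‖q.2‖ + b := by
          gcongr
          · rw [norm_smul, Real.norm_of_nonneg hε]
            exact mul_le_of_le_one_left (norm_nonneg _) hε1
          · exact hb _
        _ = _ := by ring
    have h3 : (1 + (b + ‖q.2‖)) ^ (n + 1) ≤ (1 + b) ^ (n + 1) * (1 + ‖q.2‖) ^ (n + 1) := by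
      rw [← mul_pow]
      refine pow_le_pow_left₀ (by positivity) ?_ _
      nlinarith [mul_nonneg hb0 (norm_nonneg q.2)]
    have hw := (weight_pos q.1).le
    rw [norm_mul, norm_mul, Real.norm_of_nonneg (hp.nonneg _), Real.norm_eq_abs (g _)]
    calc |g q.1| * ‖φ (Φ q.1 + ε • q.2)‖ * p q.2
        ≤ G * (M * ((1 + b) ^ (n + 1) * (1 + ‖q.2‖) ^ (n + 1) * weight q.1)) * p q.2 := by
          refine mul_le_mul_of_nonneg_right (mul_le_mul (hG _) ((hM _).trans ?_) (norm_nonneg _) hG0)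
            (hp.nonneg _)
          exact mul_le_mul_of_nonneg_left (h1.trans (mul_le_mul_of_nonneg_right h3 hw)) hM0
      _ = G * M * (1 + b) ^ (n + 1) * weight q.1 * (p q.2 * (1 + ‖q.2‖) ^ (n + 1)) := by ring
      _ ≤ _ := mul_le_mul_of_nonneg_left (hA _) (mul_nonneg (by positivity) hw)
  have hbi : Integrable (fun q : Sp n × Sp n =>
      G * M * (1 + b) ^ (n + 1) * weight q.1 * (A * weight q.2)) (ν.prod volume) :=
    ((h.integrable integrable_weight).const_mul _).mul_prod (integrable_weight.const_mul A)
  have hint : ∀ ε : ℝ, 0 ≤ ε → ε ≤ 1 → Integrable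
      (fun q : Sp n × Sp n => g q.1 * φ (Φ q.1 + ε • q.2) * p q.2) (ν.prod volume) :=
    fun ε hε hε1 => hbi.mono' (hcont ε).aestronglyMeasurable (Eventually.of_forall (hbd ε hε hε1))
  have hIoc : ∀ᶠ ε : ℝ in 𝓝[>] 0, 0 < ε ∧ ε ≤ 1 := by
    filter_upwards [Ioc_mem_nhdsGT (zero_lt_one' ℝ)] with ε hε using hε
  have hlim : Tendsto (fun ε : ℝ => ∫ q : Sp n × Sp n, g q.1 * φ (Φ q.1 + ε • q.2) * p q.2
      ∂(ν.prod volume)) (𝓝[>] 0)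
      (𝓝 (∫ q : Sp n × Sp n, g q.1 * φ (Φ q.1 + (0 : ℝ) • q.2) * p q.2 ∂(ν.prod volume))) := by
    refine tendsto_integral_filter_of_dominated_convergence _
      (Eventually.of_forall fun ε => (hcont ε).aestronglyMeasurable) ?_ hbi
      (Eventually.of_forall fun q => ?_)
    · filter_upwards [hIoc] with ε hε using Eventually.of_forall (hbd ε hε.1.le hε.2)
    · have : Continuous fun ε : ℝ => g q.1 * φ (Φ q.1 + ε • q.2) * p q.2 :=
        (continuous_const.mul (hφ.comp (continuous_const.add
          (continuous_id.smul continuous_const)))).mul continuous_const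
      exact (this.tendsto 0).mono_left nhdsWithin_le_nhds
  rw [integral_prod _ (hint 0 le_rfl zero_le_one)] at hlim
  simp only [zero_smul, add_zero, integral_const_mul, hp.integral_eq_one, mul_one] at hlim
  refine hlim.congr' ?_
  filter_upwards [hIoc] with ε hε
  rw [integral_prod _ (hint ε hε.1.le hε.2), h.integral_mul_smear hp hg hG hφ hφc hε.1 hε.2]

/-- The uniform local bound on the smearings permits dominated convergence on the support of `φ`, so
the pointwise limit and the weak limit agree. -/
theorem integral_mul_eq_of_tendsto_smear (h : IsBoundedTransport ν Φ) (hp : IsDecayingDensity p)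
    (hΦ : LocallyBoundedImage ν Φ) (hg : Continuous g) (hG : ∀ x, |g x| ≤ G) {F : Sp n → ℝ}
    (hF : ∀ y, Tendsto (fun ε => smear p ν Φ g ε y) (𝓝[>] 0) (𝓝 (F y)))
    (hφ : Continuous φ) (hφc : HasCompactSupport φ) :
    ∫ y, φ y * F y = ∫ x, g x * φ (Φ x) ∂ν := by
  obtain ⟨R, hR⟩ := hφc.isCompact.isBounded.subset_closedBall 0
  obtain ⟨C', hC'⟩ := hΦ (R + 1)
  obtain ⟨M, hM0, hM⟩ := h.integral_dilate_bounded hp hC'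
  have hG0 : 0 ≤ G := (abs_nonneg _).trans (hG 0)
  refine tendsto_nhds_unique ?_ (h.tendsto_integral_mul_smear hp hg hG hφ hφc)
  have hIoc : ∀ᶠ ε : ℝ in 𝓝[>] 0, 0 < ε ∧ ε ≤ 1 := by
    filter_upwards [Ioc_mem_nhdsGT (zero_lt_one' ℝ)] with ε hε using hε
  refine tendsto_integral_filter_of_dominated_convergence (fun y => ‖φ y‖ * (G * M)) ?_ ?_
    ((hφ.integrable_of_hasCompactSupport hφc).norm.mul_const _)
    (Eventually.of_forall fun y => (hF y).const_mul _)
  · filter_upwards [hIoc] with ε hε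
    exact (hφ.mul (h.continuous_smear hp hg hG hε.1 hε.2)).aestronglyMeasurable
  · filter_upwards [hIoc] with ε hε
    refine Eventually.of_forall fun y => ?_
    rcases eq_or_ne (φ y) 0 with h0 | h0
    · simp [h0]
    · have hy : ‖y‖ ≤ R := by simpa using hR (subset_tsupport _ h0)
      rw [norm_mul]
      refine mul_le_mul_of_nonneg_left ?_ (norm_nonneg _)
      exact (h.abs_smear_le hp hG hε.1 hε.2 y).trans
        (mul_le_mul_of_nonneg_left (hM ε hε.1 hε.2 y hy) hG0)

end IsBoundedTransport

/-! ### Free transport and the velocity distribution at a point -/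

/-- The map transporting particles along free trajectories for a time `t`. -/
def freeFlow {n : ℕ} (u₀ : Sp n → Sp n) (t : ℝ) (x : Sp n) : Sp n := x + t • u₀ x

/-- The initial distribution of positions. -/
def massMeasure {n : ℕ} (ρ₀ : Sp n → ℝ) : Measure (Sp n) :=
  volume.withDensity (fun x => ENNReal.ofReal (ρ₀ x))

theorem isBoundedTransport_massMeasure {n : ℕ} {u₀ : Sp n → Sp n} (hu₀ : Continuous u₀)
    (hu₀b : ∃ C : ℝ, ∀ x, ‖u₀ x‖ ≤ C) {ρ₀ : Sp n → ℝ} (hρ₀b : ∃ C : ℝ, ∀ x, ρ₀ x ≤ C) (t : ℝ) :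
    IsBoundedTransport (massMeasure ρ₀) (freeFlow u₀ t) := by
  obtain ⟨C, hC⟩ := hρ₀b
  obtain ⟨D, hD⟩ := hu₀b
  refine ⟨⟨C.toNNReal, ?_⟩, continuous_id.add (hu₀.const_smul t), |t| * D, ?_, fun x => ?_⟩
  · calc massMeasure ρ₀ ≤ volume.withDensity (fun _ => ENNReal.ofReal C) :=
          withDensity_mono (Eventually.of_forall fun x => ENNReal.ofReal_le_ofReal (hC x))
      _ = C.toNNReal • volume := by rw [withDensity_const]; rfl
  · exact mul_nonneg (abs_nonneg t) ((norm_nonneg _).trans (hD 0))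
  · rw [freeFlow, add_sub_cancel_left, norm_smul, Real.norm_eq_abs]
    exact mul_le_mul_of_nonneg_left (hD x) (abs_nonneg t)

section

variable {n : ℕ} {p : Sp n → ℝ} {ν : Measure (Sp n)} {u₀ : Sp n → Sp n} {t ε : ℝ}

/-- The distribution of the velocities at a point `y`, when the particles which start from the
distribution `ν` with velocities `u₀` are displaced by a noise with density `dilate p ε`. -/
def velocityLaw (p : Sp n → ℝ) (ν : Measure (Sp n)) (u₀ : Sp n → Sp n) (t ε : ℝ) (y : Sp n) :
    Measure (Sp n) :=
  (ν.withDensity (fun x => ENNReal.ofReal (dilate p ε (y - freeFlow u₀ t x)))).map u₀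

theorem lintegral_velocityLaw (h : IsBoundedTransport ν (freeFlow u₀ t))
    (hp : IsDecayingDensity p) (hu₀ : Continuous u₀) (y : Sp n) {f : Sp n → ℝ≥0∞}
    (hf : Measurable f) :
    ∫⁻ u, f u ∂(velocityLaw p ν u₀ t ε y) =
      ∫⁻ x, ENNReal.ofReal (dilate p ε (y - freeFlow u₀ t x)) * f (u₀ x) ∂ν := by
  rw [velocityLaw, lintegral_map hf hu₀.measurable]
  exact lintegral_withDensity_eq_lintegral_mul _ (ENNReal.measurable_ofReal.comp
    ((hp.continuous_dilate ε).comp (continuous_const.sub h.continuous)).measurable)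
    (hf.comp hu₀.measurable)

theorem integral_velocityLaw (h : IsBoundedTransport ν (freeFlow u₀ t))
    (hp : IsDecayingDensity p) (hε : 0 < ε) (hu₀ : Continuous u₀) (y : Sp n) {g : Sp n → ℝ}
    (hg : Continuous g) :
    ∫ u, g u ∂(velocityLaw p ν u₀ t ε y) =
      smear p ν (freeFlow u₀ t) (fun x => g (u₀ x)) ε y := by
  have hm : Measurable fun x => ENNReal.ofReal (dilate p ε (y - freeFlow u₀ t x)) :=
    ENNReal.measurable_ofReal.comp
      ((hp.continuous_dilate ε).comp (continuous_const.sub h.continuous)).measurable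
  rw [velocityLaw, integral_map hu₀.aemeasurable hg.aestronglyMeasurable,
    integral_withDensity_eq_integral_toReal_smul hm
      (Eventually.of_forall fun x => ENNReal.ofReal_lt_top), smear]
  refine integral_congr_ae (Eventually.of_forall fun x => ?_)
  simp only
  rw [ENNReal.toReal_ofReal (hp.dilate_nonneg hε.le _), smul_eq_mul, mul_comm]

theorem isFiniteMeasure_velocityLaw (h : IsBoundedTransport ν (freeFlow u₀ t))
    (hp : IsDecayingDensity p) (hε : 0 < ε) (hε1 : ε ≤ 1) (y : Sp n) :
    IsFiniteMeasure (velocityLaw p ν u₀ t ε y) := by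
  have : IsFiniteMeasure
      (ν.withDensity (fun x => ENNReal.ofReal (dilate p ε (y - freeFlow u₀ t x)))) :=
    isFiniteMeasure_withDensity (h.integrable_dilate hp hε hε1 y).lintegral_lt_top.ne
  exact Measure.isFiniteMeasure_map _ _

/-- `velocityLaw` as a finite measure. -/
def velocityFiniteMeasure (h : IsBoundedTransport ν (freeFlow u₀ t))
    (hp : IsDecayingDensity p) (hε : 0 < ε) (hε1 : ε ≤ 1) (y : Sp n) : FiniteMeasure (Sp n) :=
  ⟨velocityLaw p ν u₀ t ε y, isFiniteMeasure_velocityLaw h hp hε hε1 y⟩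

theorem coe_velocityFiniteMeasure (h : IsBoundedTransport ν (freeFlow u₀ t))
    (hp : IsDecayingDensity p) (hε : 0 < ε) (hε1 : ε ≤ 1) (y : Sp n) :
    (velocityFiniteMeasure h hp hε hε1 y : Measure (Sp n)) = velocityLaw p ν u₀ t ε y := rfl

/-- Testing against a bounded continuous function of the velocity gives a smearing, which is
continuous in `y`. -/
theorem continuous_velocityFiniteMeasure (h : IsBoundedTransport ν (freeFlow u₀ t))
    (hp : IsDecayingDensity p) (hε : 0 < ε) (hε1 : ε ≤ 1) (hu₀ : Continuous u₀) :
    Continuous (velocityFiniteMeasure h hp hε hε1) := by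
  rw [FiniteMeasure.continuous_iff_forall_continuous_lintegral]
  intro g
  have hgc : Continuous fun u => (g u : ℝ) := NNReal.continuous_coe.comp g.continuous
  obtain ⟨G, hG⟩ : ∃ G : ℝ, ∀ u, |(g u : ℝ)| ≤ G := by
    refine ⟨nndist g 0, fun u => ?_⟩
    rw [abs_of_nonneg (NNReal.coe_nonneg (g u))]
    exact_mod_cast BoundedContinuousFunction.NNReal.upper_bound g u
  have hc := h.continuous_smear hp (hgc.comp hu₀) (fun x => hG (u₀ x)) hε hε1
  refine (ENNReal.continuous_ofReal.comp hc).congr fun y => ?_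
  have := isFiniteMeasure_velocityLaw h hp hε hε1 y
  have hi : Integrable (fun u => (g u : ℝ)) (velocityLaw p ν u₀ t ε y) :=
    Integrable.of_bound hgc.aestronglyMeasurable G (Eventually.of_forall hG)
  simp only [Function.comp_apply, coe_velocityFiniteMeasure]
  have h2 := integral_velocityLaw (ε := ε) h hp hε hu₀ y hgc
  simp only [Function.comp_def]
  rw [← h2, ofReal_integral_eq_lintegral_ofReal hi (Eventually.of_forall fun u => (g u).2)]
  simp

end

/-! ### The joint law when the velocity carries no noise -/

section

variable {n : ℕ} {Ω : Type*} {mΩ : MeasurableSpace Ω} {Pr : Measure Ω} [IsProbabilityMeasure Pr]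
  {W : Fin 2 → Fin n → ℝ≥0 → Ω → ℝ} {p : Sp n → ℝ} {u₀ : Sp n → Sp n} {ρ₀ : Sp n → ℝ} {t ε : ℝ≥0}

theorem velocity_of_snd_eq_zero (v : Sp n) (ω : Ω) : velocity W (ε, 0) v t ω = v := by
  simp [velocity]

theorem position_of_snd_eq_zero (x v : Sp n) (ω : Ω) :
    position W (ε, 0) x v t ω = x + (t : ℝ) • v + (ε : ℝ) • vec (W 0) t ω := by
  simp [position, velocity]

theorem lintegral_jointLaw (hW : IsBrownianPair W Pr) (hp : IsDecayingDensity p)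
    (hlaw : Pr.map (vec (W 0) t) = volume.withDensity (fun z => ENNReal.ofReal (p z)))
    (hu₀ : Continuous u₀) (hε : 0 < ε) {f : Sp n × Sp n → ℝ≥0∞} (hf : Measurable f) :
    ∫⁻ q, f q ∂(jointLaw W Pr ρ₀ u₀ (ε, 0) t) =
      ∫⁻ x, (∫⁻ y, f (y, u₀ x) * ENNReal.ofReal (dilate p ε (y - freeFlow u₀ t x)))
        ∂(massMeasure ρ₀) := by
  have hv := hW.aemeasurable_vec 0 t
  have hm : AEMeasurable (fun q : (Sp n × Sp n) × Ω =>
      (q.1.1 + (t : ℝ) • q.1.2 + (ε : ℝ) • vec (W 0) t q.2, q.1.2))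
      ((initialLaw ρ₀ u₀).prod Pr) := by
    have h2 : AEMeasurable (fun q : (Sp n × Sp n) × Ω => vec (W 0) t q.2)
        ((initialLaw ρ₀ u₀).prod Pr) := hv.comp_snd
    fun_prop
  have hpm : Measurable fun z => ENNReal.ofReal (p z) :=
    ENNReal.measurable_ofReal.comp hp.continuous.measurable
  have hsf : SFinite (initialLaw ρ₀ u₀) := by unfold initialLaw; infer_instance
  have inner : ∀ a v : Sp n, ∫⁻ ω, f (a + (ε : ℝ) • vec (W 0) t ω, v) ∂Pr =
      ∫⁻ z, f (a + (ε : ℝ) • z, v) * ENNReal.ofReal (p z) := by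
    intro a v
    have hfm : Measurable fun z : Sp n => f (a + (ε : ℝ) • z, v) := by fun_prop
    rw [← lintegral_map' (f := fun z => f (a + (ε : ℝ) • z, v)) hfm.aemeasurable hv, hlaw,
      lintegral_withDensity_eq_lintegral_mul _ hpm hfm]
    simp [mul_comm]
  have hin : Measurable fun q : Sp n × Sp n =>
      ∫⁻ z, f (q.1 + (t : ℝ) • q.2 + (ε : ℝ) • z, q.2) * ENNReal.ofReal (p z) := by
    refine Measurable.lintegral_prod_right' (f := fun r : (Sp n × Sp n) × Sp n =>
      f (r.1.1 + (t : ℝ) • r.1.2 + (ε : ℝ) • r.2, r.1.2) * ENNReal.ofReal (p r.2)) ?_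
    exact (hf.comp (by fun_prop)).mul (hpm.comp measurable_snd)
  unfold jointLaw
  simp only [velocity_of_snd_eq_zero, position_of_snd_eq_zero]
  rw [lintegral_map' hf.aemeasurable hm]
  refine (lintegral_prod _ (hf.comp_aemeasurable hm)).trans ?_
  simp only [Function.comp_def, inner]
  rw [initialLaw, lintegral_map hin (by fun_prop)]
  refine lintegral_congr fun x => ?_
  rw [lintegral_mul_dilate (by exact_mod_cast hε) (fun y => f (y, u₀ x))]
  rfl

/-- Tonelli exchanges the starting point `x` with the observed point `y`, which disintegrates the
law over `y`. -/
theorem isPhaseDensity_velocityFiniteMeasure (hW : IsBrownianPair W Pr) (hp : IsDecayingDensity p)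
    (hlaw : Pr.map (vec (W 0) t) = volume.withDensity (fun z => ENNReal.ofReal (p z)))
    (hu₀ : Continuous u₀) (h : IsBoundedTransport (massMeasure ρ₀) (freeFlow u₀ t))
    (hε : 0 < (ε : ℝ)) (hε1 : (ε : ℝ) ≤ 1) :
    IsPhaseDensity (jointLaw W Pr ρ₀ u₀ (ε, 0) t)
      (velocityFiniteMeasure h hp hε hε1) where
  continuous := continuous_velocityFiniteMeasure h hp hε hε1 hu₀
  lintegral_eq f hf := by
    have := h.sigmaFinite
    rw [lintegral_jointLaw hW hp hlaw hu₀ (by exact_mod_cast hε) hf, lintegral_lintegral_swap]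
    · refine lintegral_congr fun y => ?_
      rw [coe_velocityFiniteMeasure]
      refine Eq.trans ?_
        (lintegral_velocityLaw h hp hu₀ y (hf.comp (measurable_prodMk_left (x := y)))).symm
      simp [mul_comm]
    · have h1 : Measurable fun q : Sp n × Sp n => f (q.2, u₀ q.1) := hf.comp (by fun_prop)
      have h2 : Continuous fun q : Sp n × Sp n => dilate p ε (q.2 - freeFlow u₀ t q.1) :=
        (hp.continuous_dilate ε).comp (continuous_snd.sub (h.continuous.comp continuous_fst))
      exact (h1.mul (ENNReal.measurable_ofReal.comp h2.measurable)).aemeasurable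

theorem massDensity_jointLaw (hW : IsBrownianPair W Pr) (hp : IsDecayingDensity p)
    (hlaw : Pr.map (vec (W 0) t) = volume.withDensity (fun z => ENNReal.ofReal (p z)))
    (hu₀ : Continuous u₀) (h : IsBoundedTransport (massMeasure ρ₀) (freeFlow u₀ t))
    (hε : 0 < (ε : ℝ)) (hε1 : (ε : ℝ) ≤ 1) (y : Sp n) :
    massDensity (jointLaw W Pr ρ₀ u₀ (ε, 0) t) y =
      smear p (massMeasure ρ₀) (freeFlow u₀ t) (fun _ => 1) ε y := by
  rw [massDensity, (isPhaseDensity_velocityFiniteMeasure hW hp hlaw hu₀ h hε hε1).phaseDensity_eq,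
    ← integral_velocityLaw h hp hε hu₀ y continuous_const, coe_velocityFiniteMeasure]
  simp

theorem massDensity_mul_meanVelocity_jointLaw (hW : IsBrownianPair W Pr) (hp : IsDecayingDensity p)
    (hlaw : Pr.map (vec (W 0) t) = volume.withDensity (fun z => ENNReal.ofReal (p z)))
    (hu₀ : Continuous u₀) (hu₀b : ∃ C : ℝ, ∀ x, ‖u₀ x‖ ≤ C)
    (h : IsBoundedTransport (massMeasure ρ₀) (freeFlow u₀ t))
    (hε : 0 < (ε : ℝ)) (hε1 : (ε : ℝ) ≤ 1) (y : Sp n) (i : Fin n) :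
    massDensity (jointLaw W Pr ρ₀ u₀ (ε, 0) t) y *
        meanVelocity (jointLaw W Pr ρ₀ u₀ (ε, 0) t) y i =
      smear p (massMeasure ρ₀) (freeFlow u₀ t) (fun x => u₀ x i) ε y := by
  obtain ⟨C, hC⟩ := hu₀b
  have hfin := isFiniteMeasure_velocityLaw h hp hε hε1 y
  -- The velocity law is carried by the range of `u₀`, hence by a ball of radius `C`.
  have hint : Integrable (fun u => u) (velocityLaw p (massMeasure ρ₀) u₀ t ε y) := by
    refine Integrable.of_bound continuous_id.aestronglyMeasurable C ?_
    refine (ae_map_iff hu₀.aemeasurable ?_).2 (Eventually.of_forall hC)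
    exact measurableSet_le continuous_norm.measurable measurable_const
  have h1 := integral_velocityLaw h hp hε hu₀ y (EuclideanSpace.proj (𝕜 := ℝ) i).continuous
  rw [ContinuousLinearMap.integral_comp_comm _ hint] at h1
  rw [meanVelocity, massDensity, (isPhaseDensity_velocityFiniteMeasure hW hp hlaw hu₀ h hε hε1).phaseDensity_eq,
    coe_velocityFiniteMeasure]
  refine Eq.trans ?_ h1
  rw [PiLp.smul_apply, smul_eq_mul]
  -- If no mass is present at `y`, the convention `0⁻¹ = 0` is harmless, because the momentum also
  -- vanishes there.
  rcases eq_or_ne ((velocityLaw p (massMeasure ρ₀) u₀ t ε y).real Set.univ) 0 with h0 | h0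
  · have h2 : velocityLaw p (massMeasure ρ₀) u₀ t ε y = 0 := by
      rw [measureReal_eq_zero_iff] at h0
      exact Measure.measure_univ_eq_zero.1 h0
    simp [h2]
  · exact mul_inv_cancel_left₀ h0 _

end

/-! ### `C¹` functions on a slab closed at time zero -/

section Slab

variable {n : ℕ} {T : ℝ≥0∞} {F : Type*} [NormedAddCommGroup F] [NormedSpace ℝ F]
  {f : ℝ → Sp n → F}

theorem slab_mem_nhds {t : ℝ} (ht : 0 < t) (htT : ENNReal.ofReal t < T) (x : Sp n) :
    slab n T ∈ 𝓝 (t, x) := by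
  have hc : Continuous fun p : ℝ × Sp n => ENNReal.ofReal p.1 :=
    ENNReal.continuous_ofReal.comp continuous_fst
  have ho : IsOpen {p : ℝ × Sp n | 0 < p.1 ∧ ENNReal.ofReal p.1 < T} :=
    (isOpen_lt continuous_const continuous_fst).inter (isOpen_lt hc continuous_const)
  exact mem_of_superset (ho.mem_nhds ⟨ht, htT⟩) fun p hp => ⟨hp.1.le, hp.2⟩

/-- A nonempty slab is convex with nonempty interior, so derivatives within it are unique even at
the boundary time `0`. -/
theorem uniqueDiffOn_slab : UniqueDiffOn ℝ (slab n T) := by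
  rcases eq_or_ne T 0 with rfl | hT
  · have : slab n 0 = ∅ := by ext; simp [slab]
    rw [this]
    exact uniqueDiffOn_empty
  · obtain ⟨s, hs0, hsT⟩ := ENNReal.lt_iff_exists_nnreal_btwn.1 (pos_iff_ne_zero.2 hT)
    refine uniqueDiffOn_convex ?_ ⟨((s : ℝ), 0), mem_interior_iff_mem_nhds.2
      (slab_mem_nhds (by exact_mod_cast hs0) (by simpa using hsT) 0)⟩
    have hord : Set.OrdConnected {r : ℝ | 0 ≤ r ∧ ENNReal.ofReal r < T} :=
      ⟨fun a ha b hb c hc =>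
        ⟨ha.1.trans hc.1, (ENNReal.ofReal_le_ofReal hc.2).trans_lt hb.2⟩⟩
    exact hord.convex.is_linear_preimage (f := fun p : ℝ × Sp n => p.1)
      ⟨fun _ _ => rfl, fun _ _ => rfl⟩

/-- The full derivative in the slab. -/
def slabDeriv (T : ℝ≥0∞) (f : ℝ → Sp n → F) (t : ℝ) (x : Sp n) : ℝ × Sp n →L[ℝ] F :=
  fderivWithin ℝ (Function.uncurry f) (slab n T) (t, x)

theorem continuousOn_slabDeriv (hf : ContDiffOn ℝ 1 (Function.uncurry f) (slab n T)) :
    ContinuousOn (fun p : ℝ × Sp n => slabDeriv T f p.1 p.2) (slab n T) :=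
  hf.continuousOn_fderivWithin uniqueDiffOn_slab le_rfl

theorem hasFDerivWithinAt_slabDeriv (hf : ContDiffOn ℝ 1 (Function.uncurry f) (slab n T)) {t : ℝ}
    {x : Sp n} (h : (t, x) ∈ slab n T) :
    HasFDerivWithinAt (Function.uncurry f) (slabDeriv T f t x) (slab n T) (t, x) :=
  (hf.differentiableOn one_ne_zero _ h).hasFDerivWithinAt

theorem hasDerivWithinAt_time (hf : ContDiffOn ℝ 1 (Function.uncurry f) (slab n T)) {t : ℝ}
    {x : Sp n} (h : (t, x) ∈ slab n T) :
    HasDerivWithinAt (fun s => f s x) (slabDeriv T f t x (1, 0)) (Set.Ici 0) t := by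
  have hT : ∀ᶠ s in 𝓝[Set.Ici 0] t, ENNReal.ofReal s < T :=
    nhdsWithin_le_nhds ((isOpen_lt ENNReal.continuous_ofReal continuous_const).mem_nhds h.2)
  have h1 : HasDerivWithinAt (fun s => f s x) (slabDeriv T f t x (1, 0))
      (Set.Ici 0 ∩ {s | ENNReal.ofReal s < T}) t :=
    (hasFDerivWithinAt_slabDeriv hf h).comp_hasDerivWithinAt_of_eq (f := fun s : ℝ => (s, x)) t
      ((hasDerivWithinAt_id t _).prodMk (hasDerivWithinAt_const t _ x))
      (fun s hs => ⟨hs.1, hs.2⟩) rfl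
  exact h1.mono_of_mem_nhdsWithin (inter_mem self_mem_nhdsWithin hT)

theorem hasFDerivAt_space (hf : ContDiffOn ℝ 1 (Function.uncurry f) (slab n T)) {t : ℝ}
    {x : Sp n} (h : (t, x) ∈ slab n T) :
    HasFDerivAt (f t) ((slabDeriv T f t x).comp (ContinuousLinearMap.inr ℝ ℝ (Sp n))) x := by
  have h1 := (hasFDerivWithinAt_slabDeriv hf h).comp (f := fun y : Sp n => (t, y))
    (s := Set.univ) x (hasFDerivAt_prodMk_right t x).hasFDerivWithinAt (fun y _ => ⟨h.1, h.2⟩)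
  exact h1.hasFDerivAt univ_mem

theorem contDiff_space (hf : ContDiffOn ℝ 1 (Function.uncurry f) (slab n T)) {t : ℝ}
    (ht : 0 ≤ t) (htT : ENNReal.ofReal t < T) : ContDiff ℝ 1 (f t) := by
  rw [← contDiffOn_univ]
  exact hf.comp (f := fun y : Sp n => (t, y)) (contDiff_prodMk_right t).contDiffOn
    (fun y _ => ⟨ht, htT⟩)

end Slab

/-! ### Characteristics of the Burgers equation -/

namespace IsClassicalBurgersSolution

variable {n : ℕ} {T : ℝ≥0∞} {u₀ : Sp n → Sp n} {u : ℝ → Sp n → Sp n}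

/-- Along the line `s ↦ x + s • v` with `v = u₀ x`, the defect `g s = u s (x + s • v) - v` vanishes
at `0`. The equation says that the derivative of `u` in the direction `(1, u)` is zero, so the
derivative of `g` is minus that in the direction `(0, g)`; Grönwall's inequality forces `g = 0`. -/
theorem apply_freeFlow (h : IsClassicalBurgersSolution u₀ T u) {t : ℝ} (ht : 0 ≤ t)
    (htT : ENNReal.ofReal t < T) (x : Sp n) : u t (freeFlow u₀ t x) = u₀ x := by
  rcases ht.eq_or_lt with rfl | ht
  · simp [freeFlow, h.initial]
  set v := u₀ x with hv
  have hmem : ∀ s ∈ Set.Icc 0 t, (s, x + s • v) ∈ slab n T := fun s hs =>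
    ⟨hs.1, (ENNReal.ofReal_le_ofReal hs.2).trans_lt htT⟩
  have hγ : Continuous fun s : ℝ => (s, x + s • v) := by fun_prop
  set D : ℝ → (ℝ × Sp n →L[ℝ] Sp n) := fun s => slabDeriv T u s (x + s • v) with hD
  have hDc : ContinuousOn D (Set.Icc 0 t) :=
    (continuousOn_slabDeriv h.smooth).comp hγ.continuousOn hmem
  obtain ⟨K, hK⟩ := isCompact_Icc.exists_bound_of_continuousOn hDc
  set g : ℝ → Sp n := fun s => u s (x + s • v) - v with hg
  have hgc : ContinuousOn g (Set.Icc 0 t) :=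
    (h.smooth.continuousOn.comp hγ.continuousOn hmem).sub continuousOn_const
  have hg' : ∀ s ∈ Set.Ico 0 t, HasDerivWithinAt g (D s (1, v)) (Set.Ici s) s := by
    intro s hs
    have hγ' : HasDerivWithinAt (fun s : ℝ => (s, x + s • v)) (1, v) (Set.Icc 0 t) s := by
      have := ((hasDerivAt_id s).smul_const v).const_add x
      simpa using! ((hasDerivAt_id s).prodMk this).hasDerivWithinAt
    have h1 := (hasFDerivWithinAt_slabDeriv h.smooth
      (hmem s ⟨hs.1, hs.2.le⟩)).comp_hasDerivWithinAt s hγ' hmem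
    refine (h1.sub_const v).mono_of_mem_nhdsWithin ?_
    exact mem_of_superset (Icc_mem_nhdsGE hs.2) (Set.Icc_subset_Icc_left hs.1)
  have hineq : ∀ s ∈ Set.Ioo 0 t, ‖D s (1, v)‖ ≤ K * ‖g s‖ := by
    intro s hs
    have hs' := hmem s ⟨hs.1.le, hs.2.le⟩
    have htime := (hasDerivWithinAt_time h.smooth hs').hasDerivAt (Ici_mem_nhds hs.1)
    have heq := h.equation s hs.1 hs'.2 (x + s • v)
    rw [htime.deriv, (hasFDerivAt_space h.smooth hs').fderiv] at heq
    have h1 : D s (1, v) = - D s (0, g s) := by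
      have e : ((1, v) : ℝ × Sp n) = (1, 0) + (0, u s (x + s • v)) - (0, g s) := by
        simp [hg]
      rw [e, map_sub, map_add]
      have : D s (1, 0) + D s (0, u s (x + s • v)) = 0 := by simpa using heq
      rw [this, zero_sub]
    rw [h1, norm_neg]
    refine (ContinuousLinearMap.le_opNorm _ _).trans ?_
    have : ‖((0, g s) : ℝ × Sp n)‖ = ‖g s‖ := by simp [Prod.norm_def]
    rw [this]
    exact mul_le_mul_of_nonneg_right (hK s ⟨hs.1.le, hs.2.le⟩) (norm_nonneg _)
  -- The equation is available only for positive times; continuity extends the bound to `s = 0`.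
  have hineq' : ∀ s ∈ Set.Ico 0 t, ‖D s (1, v)‖ ≤ K * ‖g s‖ + 0 := by
    intro s hs
    rw [add_zero]
    refine le_on_closure (s := Set.Ioo 0 t) (f := fun s => ‖D s (1, v)‖)
      (g := fun s => K * ‖g s‖) hineq ?_ ?_ ?_
    · rw [closure_Ioo ht.ne]
      exact (hDc.clm_apply continuousOn_const).norm
    · rw [closure_Ioo ht.ne]
      exact continuousOn_const.mul hgc.norm
    · rw [closure_Ioo ht.ne]
      exact ⟨hs.1, hs.2.le⟩
  have h0 : ‖g 0‖ ≤ 0 := by simp [hg, h.initial, hv]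
  have := norm_le_gronwallBound_of_norm_deriv_right_le hgc hg' h0 hineq' t ⟨ht.le, le_rfl⟩
  rw [gronwallBound_ε0_δ0] at this
  exact sub_eq_zero.1 (norm_le_zero_iff.1 this)

/-- The map `Ψ y = y - t • u t y` is a `C¹` left inverse of the flow, so the preimage of a set lies
in its image under `Ψ`, whose volume is controlled by the Jacobian, bounded on balls. Surjectivity
of the flow plays no role. -/
theorem locallyBoundedImage (h : IsClassicalBurgersSolution u₀ T u) {t : ℝ} (ht : 0 ≤ t)
    (htT : ENNReal.ofReal t < T) {ν : Measure (Sp n)}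
    (hν : IsBoundedTransport ν (freeFlow u₀ t)) : LocallyBoundedImage ν (freeFlow u₀ t) := by
  intro R
  obtain ⟨C, hC⟩ := hν.le
  have hu := contDiff_space h.smooth ht htT
  set Ψ : Sp n → Sp n := fun y => y - t • u t y with hΨ
  have hΨd : ContDiff ℝ 1 Ψ := contDiff_id.sub (hu.const_smul t)
  have hΨΦ : ∀ x, Ψ (freeFlow u₀ t x) = x := fun x => by
    simp only [hΨ, h.apply_freeFlow ht htT]
    simp [freeFlow]
  have hdet : Continuous fun y => |(fderiv ℝ Ψ y).det| :=
    (ContinuousLinearMap.continuous_det.comp (hΨd.continuous_fderiv one_ne_zero)).abs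
  obtain ⟨M, hM⟩ := (isCompact_closedBall (0 : Sp n) R).exists_bound_of_continuousOn
    hdet.continuousOn
  refine ⟨C * M.toNNReal, Measure.le_iff.2 fun A hA => ?_⟩
  have hAB : MeasurableSet (A ∩ Metric.ball 0 R) := hA.inter Metric.isOpen_ball.measurableSet
  rw [Measure.restrict_apply hA, Measure.map_apply hν.continuous.measurable hAB]
  have hsub : freeFlow u₀ t ⁻¹' (A ∩ Metric.ball 0 R) ⊆ Ψ '' (A ∩ Metric.ball 0 R) :=
    fun x hx => ⟨_, hx, hΨΦ x⟩
  have h1 : volume (Ψ '' (A ∩ Metric.ball 0 R)) ≤ M.toNNReal * volume A := by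
    calc volume (Ψ '' (A ∩ Metric.ball 0 R))
        ≤ ∫⁻ y in A ∩ Metric.ball 0 R, ENNReal.ofReal |(fderiv ℝ Ψ y).det| :=
          addHaar_image_le_lintegral_abs_det_fderiv _ hAB fun y _ =>
            ((hΨd.differentiable one_ne_zero) y).hasFDerivAt.hasFDerivWithinAt
      _ ≤ ∫⁻ _ in A ∩ Metric.ball 0 R, ENNReal.ofReal M := by
          refine setLIntegral_mono measurable_const fun y hy => ENNReal.ofReal_le_ofReal ?_
          have := hM y (Metric.ball_subset_closedBall hy.2)
          rwa [Real.norm_eq_abs, abs_abs] at this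
      _ = ENNReal.ofReal M * volume (A ∩ Metric.ball 0 R) := by rw [setLIntegral_const]
      _ ≤ M.toNNReal * volume A := by
          gcongr
          · exact le_rfl
          · exact Set.inter_subset_left
  calc ν (freeFlow u₀ t ⁻¹' (A ∩ Metric.ball 0 R))
      ≤ (C • volume) (freeFlow u₀ t ⁻¹' (A ∩ Metric.ball 0 R)) := hC _
    _ = C * volume (freeFlow u₀ t ⁻¹' (A ∩ Metric.ball 0 R)) := by
        rw [Measure.smul_apply]; rfl
    _ ≤ C * (M.toNNReal * volume A) := by
        gcongr
        exact (measure_mono hsub).trans h1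
    _ = ((C * M.toNNReal) • volume) A := by
        rw [Measure.smul_apply, ← mul_assoc, ← ENNReal.coe_mul]; rfl

end IsClassicalBurgersSolution

/-! ### From transported measures to conservation laws -/

theorem clm_apply_eq_sum {n : ℕ} (L : Sp n →L[ℝ] ℝ) (v : Sp n) :
    L v = ∑ k, v k * L (EuclideanSpace.single k 1) := by
  conv_lhs => rw [← (EuclideanSpace.basisFun (Fin n) ℝ).sum_repr v]
  simp [map_sum]

section Conservation

variable {n : ℕ} {T : ℝ≥0∞} {u₀ : Sp n → Sp n} {ν : Measure (Sp n)} {g φ : Sp n → ℝ}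
  {a : ℝ → Sp n → ℝ}

theorem exists_closedBall_subset {t : ℝ} (ht : 0 < t) (htT : ENNReal.ofReal t < T) :
    ∃ δ > 0, ∀ s ∈ Metric.closedBall t δ, 0 < s ∧ ENNReal.ofReal s < T := by
  have h : {s : ℝ | 0 < s ∧ ENNReal.ofReal s < T} ∈ 𝓝 t :=
    ((isOpen_lt continuous_const continuous_id).inter
      (isOpen_lt ENNReal.continuous_ofReal continuous_const)).mem_nhds ⟨ht, htT⟩
  obtain ⟨δ, hδ, hsub⟩ := Metric.nhds_basis_closedBall.mem_iff.1 h
  exact ⟨δ, hδ, fun s hs => hsub hs⟩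

theorem hasDerivAt_integral_mul (ha : ContDiffOn ℝ 1 (Function.uncurry a) (slab n T))
    (hφ : Continuous φ) (hφc : HasCompactSupport φ) {t : ℝ} (ht : 0 < t)
    (htT : ENNReal.ofReal t < T) :
    HasDerivAt (fun s => ∫ y, φ y * a s y) (∫ y, φ y * slabDeriv T a t y (1, 0)) t := by
  obtain ⟨δ, hδ, hball⟩ := exists_closedBall_subset ht htT
  have hDc : ContinuousOn (fun p : ℝ × Sp n => slabDeriv T a p.1 p.2 (1, 0)) (slab n T) :=
    (continuousOn_slabDeriv ha).clm_apply continuousOn_const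
  obtain ⟨M, hM⟩ := ((isCompact_closedBall t δ).prod hφc.isCompact).exists_bound_of_continuousOn
    (hDc.mono fun p hp => ⟨(hball p.1 hp.1).1.le, (hball p.1 hp.1).2⟩)
  have hslice : ∀ s ∈ Metric.closedBall t δ, Continuous (a s) := fun s hs =>
    (contDiff_space ha (hball s hs).1.le (hball s hs).2).continuous
  have hφi := hφ.integrable_of_hasCompactSupport (μ := volume) hφc
  refine (hasDerivAt_integral_of_dominated_loc_of_deriv_le
    (F' := fun s y => φ y * slabDeriv T a s y (1, 0)) (bound := fun y => ‖φ y‖ * M)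
    (Metric.closedBall_mem_nhds t hδ) ?_ ?_ ?_ ?_ (hφi.norm.mul_const M) ?_).2
  · filter_upwards [Metric.closedBall_mem_nhds t hδ] with s hs
    exact (hφ.mul (hslice s hs)).aestronglyMeasurable
  · exact (hφ.mul (hslice t (Metric.mem_closedBall_self hδ.le))).integrable_of_hasCompactSupport
      hφc.mul_right
  · have : Continuous fun y => slabDeriv T a t y (1, 0) :=
      hDc.comp_continuous (f := fun y : Sp n => (t, y)) (by fun_prop) fun y => ⟨ht.le, htT⟩
    exact (hφ.mul this).aestronglyMeasurable
  · refine Eventually.of_forall fun y s hs => ?_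
    rcases eq_or_ne (φ y) 0 with h0 | h0
    · simp [h0]
    · rw [norm_mul]
      exact mul_le_mul_of_nonneg_left (hM (s, y) ⟨hs, subset_tsupport _ h0⟩) (norm_nonneg _)
  · refine Eventually.of_forall fun y s hs => ?_
    have hs' := hball s hs
    exact ((hasDerivWithinAt_time ha (x := y) ⟨hs'.1.le, hs'.2⟩).hasDerivAt
      (Ici_mem_nhds hs'.1)).const_mul _

theorem hasDerivAt_integral_comp_freeFlow (hu₀ : Continuous u₀)
    (hu₀b : ∃ C : ℝ, ∀ x, ‖u₀ x‖ ≤ C) (hν : ∀ t, IsBoundedTransport ν (freeFlow u₀ t))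
    (hg : Continuous g) (hφ : ContDiff ℝ 1 φ) (hφc : HasCompactSupport φ) (t : ℝ) :
    HasDerivAt (fun s => ∫ x, g x * φ (freeFlow u₀ s x) ∂ν)
      (∫ x, g x * fderiv ℝ φ (freeFlow u₀ t x) (u₀ x) ∂ν) t := by
  obtain ⟨C, hC⟩ := hu₀b
  have hC0 : 0 ≤ C := (norm_nonneg _).trans (hC 0)
  obtain ⟨R, hR⟩ := hφc.isCompact.isBounded.subset_closedBall 0
  have hφ'c : Continuous (fderiv ℝ φ) := hφ.continuous_fderiv one_ne_zero
  obtain ⟨K, hK⟩ := (hφc.fderiv (𝕜 := ℝ)).exists_bound_of_continuous hφ'c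
  have hK0 : 0 ≤ K := (norm_nonneg _).trans (hK 0)
  -- During times `|s - t| ≤ 1` a particle travels at most `(|t| + 1) * C`, so those that meet the
  -- support of `φ` start in `B`.
  set B : Set (Sp n) := Metric.closedBall 0 (R + (|t| + 1) * C) with hB
  have hcont : ∀ s, Continuous (freeFlow u₀ s) := fun s => (hν s).continuous
  refine (hasDerivAt_integral_of_dominated_loc_of_deriv_le
    (F' := fun s x => g x * fderiv ℝ φ (freeFlow u₀ s x) (u₀ x))
    (bound := B.indicator fun x => |g x| * (K * C))
    (Metric.closedBall_mem_nhds t one_pos) ?_ ((hν t).integrable_comp hg hφ.continuous hφc)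
    ?_ ?_ ?_ ?_).2
  · exact Eventually.of_forall fun s =>
      (hg.mul (hφ.continuous.comp (hcont s))).aestronglyMeasurable
  · exact (hg.mul ((hφ'c.comp (hcont t)).clm_apply hu₀)).aestronglyMeasurable
  · refine Eventually.of_forall fun x s hs => ?_
    by_cases hx : x ∈ B
    · rw [Set.indicator_of_mem hx, norm_mul, Real.norm_eq_abs]
      refine mul_le_mul_of_nonneg_left ?_ (abs_nonneg _)
      exact (ContinuousLinearMap.le_opNorm _ _).trans
        (mul_le_mul (hK _) (hC x) (norm_nonneg _) hK0)
    · have h0 : fderiv ℝ φ (freeFlow u₀ s x) = 0 := by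
        by_contra h0
        have h1 : freeFlow u₀ s x ∈ tsupport φ :=
          support_fderiv_subset ℝ h0
        have h2 : ‖freeFlow u₀ s x‖ ≤ R := by simpa using hR h1
        apply hx
        rw [hB, mem_closedBall_zero_iff]
        have h3 : ‖x‖ ≤ ‖freeFlow u₀ s x‖ + ‖s • u₀ x‖ := by
          have : x = freeFlow u₀ s x - s • u₀ x := by simp [freeFlow]
          calc ‖x‖ = ‖freeFlow u₀ s x - s • u₀ x‖ := by rw [← this]
            _ ≤ _ := norm_sub_le _ _
        have h4 : |s| ≤ |t| + 1 := by
          rw [Metric.mem_closedBall, Real.dist_eq] at hs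
          linarith [abs_sub_abs_le_abs_sub s t]
        have h5 : ‖s • u₀ x‖ ≤ (|t| + 1) * C := by
          rw [norm_smul, Real.norm_eq_abs]
          exact mul_le_mul h4 (hC x) (norm_nonneg _) (by positivity)
        linarith
      rw [h0]
      simp [hx]
  · refine (hν t).integrable ?_
    rw [integrable_indicator_iff Metric.isClosed_closedBall.measurableSet]
    exact (hg.abs.mul continuous_const).continuousOn.integrableOn_compact (isCompact_closedBall _ _)
  · refine Eventually.of_forall fun x s _ => ?_
    have h1 : HasDerivAt (fun s => freeFlow u₀ s x) (u₀ x) s := by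
      simpa [freeFlow] using! ((hasDerivAt_id s).smul_const (u₀ x)).const_add x
    exact (((hφ.differentiable one_ne_zero _).hasFDerivAt.comp_hasDerivAt s h1)).const_mul _

variable {b : Fin n → ℝ → Sp n → ℝ}

/-- The left-hand side `∂ₜ a + div b` of a conservation law. -/
def balance (T : ℝ≥0∞) (a : ℝ → Sp n → ℝ) (b : Fin n → ℝ → Sp n → ℝ) (t : ℝ) (x : Sp n) : ℝ :=
  slabDeriv T a t x (1, 0) + ∑ k, slabDeriv T (b k) t x (0, EuclideanSpace.single k 1)

theorem continuousOn_balance (ha : ContDiffOn ℝ 1 (Function.uncurry a) (slab n T))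
    (hb : ∀ k, ContDiffOn ℝ 1 (Function.uncurry (b k)) (slab n T)) :
    ContinuousOn (fun p : ℝ × Sp n => balance T a b p.1 p.2) (slab n T) :=
  ((continuousOn_slabDeriv ha).clm_apply continuousOn_const).add
    (continuousOn_finsetSum _ fun k _ =>
      (continuousOn_slabDeriv (hb k)).clm_apply continuousOn_const)

theorem balance_eq (ha : ContDiffOn ℝ 1 (Function.uncurry a) (slab n T))
    (hb : ∀ k, ContDiffOn ℝ 1 (Function.uncurry (b k)) (slab n T)) {t : ℝ} {x : Sp n}
    (h : (t, x) ∈ slab n T) :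
    derivWithin (fun s => a s x) (Set.Ici 0) t +
      ∑ k, fderiv ℝ (b k t) x (EuclideanSpace.single k 1) = balance T a b t x := by
  rw [balance, (hasDerivWithinAt_time ha h).derivWithin (uniqueDiffOn_Ici 0 t h.1)]
  congr 1
  refine Finset.sum_congr rfl fun k _ => ?_
  rw [(hasFDerivAt_space (hb k) h).fderiv]
  rfl

/-- Densities `a` and `b` of the transported measures `g ν` and `g u₀ ν` satisfy the
conservation law `∂ₜ a + div b = 0`. -/
theorem balance_eq_zero (hu₀ : Continuous u₀)
    (hu₀b : ∃ C : ℝ, ∀ x, ‖u₀ x‖ ≤ C) (hν : ∀ t, IsBoundedTransport ν (freeFlow u₀ t))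
    (hg : Continuous g) (ha : ContDiffOn ℝ 1 (Function.uncurry a) (slab n T))
    (hb : ∀ k, ContDiffOn ℝ 1 (Function.uncurry (b k)) (slab n T))
    (hwa : ∀ t : ℝ, 0 < t → ENNReal.ofReal t < T → ∀ φ : Sp n → ℝ, Continuous φ →
      HasCompactSupport φ → ∫ y, φ y * a t y = ∫ x, g x * φ (freeFlow u₀ t x) ∂ν)
    (hwb : ∀ t : ℝ, 0 < t → ENNReal.ofReal t < T → ∀ k, ∀ φ : Sp n → ℝ, Continuous φ →
      HasCompactSupport φ →
      ∫ y, φ y * b k t y = ∫ x, g x * u₀ x k * φ (freeFlow u₀ t x) ∂ν)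
    {t : ℝ} {x : Sp n} (h : (t, x) ∈ slab n T) : balance T a b t x = 0 := by
  have hbal := continuousOn_balance ha hb
  have hpos : ∀ t : ℝ, 0 < t → ENNReal.ofReal t < T → ∀ x, balance T a b t x = 0 := by
    intro t ht htT
    have hmem : ∀ y : Sp n, (t, y) ∈ slab n T := fun y => ⟨ht.le, htT⟩
    have hc : Continuous (balance T a b t) :=
      hbal.comp_continuous (f := fun y : Sp n => (t, y)) (by fun_prop) hmem
    have hDa : Continuous fun y => slabDeriv T a t y (1, 0) :=
      ((continuousOn_slabDeriv ha).clm_apply continuousOn_const).comp_continuous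
        (f := fun y : Sp n => (t, y)) (by fun_prop) hmem
    have hDb : ∀ k, Continuous fun y => slabDeriv T (b k) t y (0, EuclideanSpace.single k 1) :=
      fun k => ((continuousOn_slabDeriv (hb k)).clm_apply continuousOn_const).comp_continuous
        (f := fun y : Sp n => (t, y)) (by fun_prop) hmem
    have hae : ∀ᵐ y, balance T a b t y = 0 := by
      refine ae_eq_zero_of_integral_contDiff_smul_eq_zero hc.locallyIntegrable
        fun φ hφ hφc => ?_
      have hφ1 : ContDiff ℝ 1 φ := hφ.of_le (by exact_mod_cast le_top)
      have hφ' := hφ1.continuous_fderiv one_ne_zero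
      have e1 := hasDerivAt_integral_mul ha hφ.continuous hφc ht htT
      have e2 := hasDerivAt_integral_comp_freeFlow hu₀ hu₀b hν hg hφ1 hφc t
      have e3 : ∫ y, φ y * slabDeriv T a t y (1, 0) =
          ∫ x, g x * fderiv ℝ φ (freeFlow u₀ t x) (u₀ x) ∂ν := by
        refine (e1.congr_of_eventuallyEq ?_).unique e2
        obtain ⟨δ, hδ, hball⟩ := exists_closedBall_subset ht htT
        filter_upwards [Metric.closedBall_mem_nhds t hδ] with s hs
        exact (hwa s (hball s hs).1 (hball s hs).2 φ hφ.continuous hφc).symm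
      have hφk : ∀ k : Fin n, Continuous fun y => fderiv ℝ φ y (EuclideanSpace.single k 1) :=
        fun k => hφ'.clm_apply continuous_const
      have hφkc : ∀ k : Fin n,
          HasCompactSupport fun y => fderiv ℝ φ y (EuclideanSpace.single k 1) :=
        fun k => hφc.fderiv_apply (𝕜 := ℝ) _
      have e4 : ∫ x, g x * fderiv ℝ φ (freeFlow u₀ t x) (u₀ x) ∂ν =
          ∑ k, ∫ x, g x * u₀ x k *
            fderiv ℝ φ (freeFlow u₀ t x) (EuclideanSpace.single k 1) ∂ν := by
        rw [← integral_finsetSum]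
        · refine integral_congr_ae (Eventually.of_forall fun x => ?_)
          simp only
          rw [clm_apply_eq_sum, Finset.mul_sum]
          simp only [mul_assoc]
        · intro k _
          have huk : Continuous fun x => g x * u₀ x k := by fun_prop
          exact (hν t).integrable_comp huk (hφk k) (hφkc k)
      -- The weak identity for the flux with test function `∂ₖφ`, followed by integration by parts.
      have e5 : ∀ k, ∫ x, g x * u₀ x k *
            fderiv ℝ φ (freeFlow u₀ t x) (EuclideanSpace.single k 1) ∂ν =
          - ∫ y, φ y * slabDeriv T (b k) t y (0, EuclideanSpace.single k 1) := by
        intro k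
        have hbk := contDiff_space (hb k) ht.le htT
        have hfd : ∀ y, fderiv ℝ (b k t) y (EuclideanSpace.single k 1) =
            slabDeriv T (b k) t y (0, EuclideanSpace.single k 1) := fun y => by
          rw [(hasFDerivAt_space (hb k) (hmem y)).fderiv]
          rfl
        rw [← hwb t ht htT k _ (hφk k) (hφkc k)]
        have := integral_mul_fderiv_eq_neg_fderiv_mul_of_integrable (μ := volume)
          (f := φ) (g := b k t) (v := EuclideanSpace.single k 1)
          (((hφk k).mul hbk.continuous).integrable_of_hasCompactSupport (hφkc k).mul_right)
          (by
            simp only [hfd]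
            exact (hφ.continuous.mul (hDb k)).integrable_of_hasCompactSupport hφc.mul_right)
          ((hφ.continuous.mul hbk.continuous).integrable_of_hasCompactSupport hφc.mul_right)
          (fun y _ => hφ1.differentiable one_ne_zero y)
          (fun y _ => hbk.differentiable one_ne_zero y)
        simp only [hfd] at this
        rw [this, neg_neg]
      simp only [balance, smul_eq_mul, mul_add, Finset.mul_sum]
      rw [integral_add, integral_finsetSum, e3, e4, Finset.sum_congr rfl fun k _ => e5 k,
        Finset.sum_neg_distrib, neg_add_cancel]
      · exact fun k _ =>
          (hφ.continuous.mul (hDb k)).integrable_of_hasCompactSupport hφc.mul_right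
      · exact (hφ.continuous.mul hDa).integrable_of_hasCompactSupport hφc.mul_right
      · exact integrable_finsetSum _ fun k _ =>
          (hφ.continuous.mul (hDb k)).integrable_of_hasCompactSupport hφc.mul_right
    exact fun x => congrFun (Measure.eq_of_ae_eq hae hc continuous_const) x
  -- The weak identities hold only for positive times; at time `0` the balance is the limit of its
  -- values at positive times.
  rcases h.1.eq_or_lt with h0 | h0
  · simp only at h0
    subst h0
    have hT : ∀ᶠ s : ℝ in 𝓝[>] 0, 0 < s ∧ ENNReal.ofReal s < T := by
      refine (eventually_mem_nhdsWithin (s := Set.Ioi (0 : ℝ))).and (nhdsWithin_le_nhds ?_)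
      exact (isOpen_lt ENNReal.continuous_ofReal continuous_const).mem_nhds h.2
    have h1 : Tendsto (fun s : ℝ => (s, x)) (𝓝[>] 0) (𝓝[slab n T] (0, x)) := by
      refine tendsto_nhdsWithin_iff.2 ⟨?_, hT.mono fun s hs => ⟨hs.1.le, hs.2⟩⟩
      have : Continuous fun s : ℝ => (s, x) := by fun_prop
      exact (this.tendsto 0).mono_left nhdsWithin_le_nhds
    refine tendsto_nhds_unique ((hbal _ h).tendsto.comp h1) ?_
    refine tendsto_const_nhds.congr' ?_
    filter_upwards [hT] with s hs using (hpos s hs.1 hs.2 x).symm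
  · exact hpos t h0 h.2 x

end Conservation

/-! ### Identification of the limits as the noise vanishes -/

section Limit

variable {n : ℕ} {Ω : Type*} {mΩ : MeasurableSpace Ω} {Pr : Measure Ω} [IsProbabilityMeasure Pr]
  {W : Fin 2 → Fin n → ℝ≥0 → Ω → ℝ} {u₀ : Sp n → Sp n} {ρ₀ : Sp n → ℝ}

theorem tendsto_toNNReal_prodMk_zero :
    Tendsto (fun ε : ℝ => ((ε.toNNReal, 0) : ℝ≥0 × ℝ≥0)) (𝓝[>] 0) (𝓝[≠] 0) := by
  refine tendsto_nhdsWithin_iff.2 ⟨?_, ?_⟩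
  · have : Continuous fun ε : ℝ => ((ε.toNNReal, 0) : ℝ≥0 × ℝ≥0) := by fun_prop
    have h := this.tendsto 0
    rw [Real.toNNReal_zero] at h
    exact h.mono_left nhdsWithin_le_nhds
  · filter_upwards [self_mem_nhdsWithin] with ε hε h
    have h1 : ε.toNNReal = 0 := congrArg Prod.fst h
    exact (Real.toNNReal_eq_zero.1 h1).not_gt hε

/-- The weak form of the limits of the mass density and of the momentum density. -/
theorem integral_mul_limit (hW : IsBrownianPair W Pr) (hu₀ : Continuous u₀)
    (hu₀b : ∃ C : ℝ, ∀ x, ‖u₀ x‖ ≤ C) {t : ℝ≥0} (ht : 0 < t)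
    (h : IsBoundedTransport (massMeasure ρ₀) (freeFlow u₀ t))
    (hΦ : LocallyBoundedImage (massMeasure ρ₀) (freeFlow u₀ t)) {r : Sp n → ℝ} {v : Sp n → Sp n}
    (hr : ∀ y, Tendsto (fun σ : ℝ≥0 × ℝ≥0 => massDensity (jointLaw W Pr ρ₀ u₀ σ t) y)
      (𝓝[≠] 0) (𝓝 (r y)))
    (hv : ∀ y, Tendsto (fun σ : ℝ≥0 × ℝ≥0 => meanVelocity (jointLaw W Pr ρ₀ u₀ σ t) y)
      (𝓝[≠] 0) (𝓝 (v y))) {φ : Sp n → ℝ} (hφ : Continuous φ) (hφc : HasCompactSupport φ) :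
    ∫ y, φ y * r y = ∫ x, φ (freeFlow u₀ t x) ∂(massMeasure ρ₀) ∧
    ∀ i, ∫ y, φ y * (r y * v y i) = ∫ x, u₀ x i * φ (freeFlow u₀ t x) ∂(massMeasure ρ₀) := by
  obtain ⟨p, hp, hlaw⟩ := hW.exists_density 0 ht
  have hIoc : ∀ᶠ ε : ℝ in 𝓝[>] 0, 0 < ε ∧ ε ≤ 1 := by
    filter_upwards [Ioc_mem_nhdsGT (zero_lt_one' ℝ)] with ε hε using hε
  have hr' := fun y => (hr y).comp tendsto_toNNReal_prodMk_zero
  have hv' := fun y => (hv y).comp tendsto_toNNReal_prodMk_zero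
  refine ⟨?_, fun i => ?_⟩
  · have := h.integral_mul_eq_of_tendsto_smear hp hΦ (g := fun _ => 1) continuous_const (G := 1)
      (fun x => by simp) (F := r) (fun y => (hr' y).congr' ?_) hφ hφc
    · simpa using this
    · filter_upwards [hIoc] with ε hε
      have he : (ε.toNNReal : ℝ) = ε := Real.coe_toNNReal _ hε.1.le
      have := massDensity_jointLaw (ε := ε.toNNReal) hW hp hlaw hu₀ h (he.symm ▸ hε.1)
        (he.symm ▸ hε.2) y
      rwa [he] at this
  · obtain ⟨C, hC⟩ := hu₀b
    refine h.integral_mul_eq_of_tendsto_smear hp hΦ (g := fun x => u₀ x i) (by fun_prop) (G := C)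
      (fun x => (PiLp.norm_apply_le (u₀ x) i).trans (hC x)) (F := fun y => r y * v y i)
      (fun y => ((hr' y).mul (((EuclideanSpace.proj (𝕜 := ℝ) i).continuous.tendsto _).comp
        (hv' y))).congr' ?_) hφ hφc
    filter_upwards [hIoc] with ε hε
    have he : (ε.toNNReal : ℝ) = ε := Real.coe_toNNReal _ hε.1.le
    have := massDensity_mul_meanVelocity_jointLaw (ε := ε.toNNReal) hW hp hlaw hu₀ ⟨C, hC⟩ h
      (he.symm ▸ hε.1) (he.symm ▸ hε.2) y i
    rwa [he] at this

/-- The momentum density of transported particles is the mass density times the velocity. -/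
theorem mul_eq_mul_of_integral {ν : Measure (Sp n)} {T : ℝ≥0∞} {u : ℝ → Sp n → Sp n}
    (hu : IsClassicalBurgersSolution u₀ T u) {t : ℝ} (ht : 0 ≤ t) (htT : ENNReal.ofReal t < T)
    {r : Sp n → ℝ} (hr : Continuous r) {v : Sp n → Sp n} (hv : Continuous v)
    (h1 : ∀ φ : Sp n → ℝ, Continuous φ → HasCompactSupport φ →
      ∫ y, φ y * r y = ∫ x, φ (freeFlow u₀ t x) ∂ν) (i : Fin n)
    (h2 : ∀ φ : Sp n → ℝ, Continuous φ → HasCompactSupport φ →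
      ∫ y, φ y * (r y * v y i) = ∫ x, u₀ x i * φ (freeFlow u₀ t x) ∂ν) (y : Sp n) :
    r y * v y i = r y * u t y i := by
  have hut : Continuous (u t) := (contDiff_space hu.smooth ht htT).continuous
  have c1 : Continuous fun y => r y * v y i := by fun_prop
  have c2 : Continuous fun y => r y * u t y i := by fun_prop
  refine congrFun (Measure.eq_of_ae_eq (μ := volume) (ae_eq_of_integral_contDiff_smul_eq
    c1.locallyIntegrable c2.locallyIntegrable fun φ hφ hφc => ?_) c1 c2) y
  -- With test function `φ uᵢ`, the mass identity produces `u` along the flow, that is, `u₀ᵢ`: the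
  -- right-hand side of the momentum identity.
  have h3 := h1 (fun y => φ y * u t y i) (by have := hφ.continuous; fun_prop) hφc.mul_right
  simp only [smul_eq_mul]
  rw [h2 φ hφ.continuous hφc]
  calc ∫ x, u₀ x i * φ (freeFlow u₀ t x) ∂ν
      = ∫ x, φ (freeFlow u₀ t x) * u t (freeFlow u₀ t x) i ∂ν := by
        simp only [hu.apply_freeFlow ht htT, mul_comm]
    _ = ∫ y, φ y * u t y i * r y := h3.symm
    _ = ∫ y, φ y * (r y * u t y i) := by
        refine integral_congr_ae (Eventually.of_forall fun y => ?_)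
        simp only
        ring

end Limit

end StochasticBurgers

end

/-! ### The pressureless gas dynamics system -/

open StochasticBurgers in
theorem theorem2p4 {n : ℕ} {Ω : Type*} [MeasurableSpace Ω] (Pr : Measure Ω)
    [IsProbabilityMeasure Pr] (W : Fin 2 → Fin n → ℝ≥0 → Ω → ℝ)
    (hW : StochasticBurgers.IsBrownianPair W Pr)
    -- the initial data
    (u₀ : EuclideanSpace ℝ (Fin n) → EuclideanSpace ℝ (Fin n)) (hu₀ : ContDiff ℝ 1 u₀)
    (hu₀b : ∃ C : ℝ, ∀ x, ‖u₀ x‖ ≤ C)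
    (ρ₀ : EuclideanSpace ℝ (Fin n) → ℝ) (hρ₀ : LocallyIntegrable ρ₀ volume)
    (hρ₀nonneg : ∀ x, 0 ≤ ρ₀ x) (hρ₀b : ∃ C : ℝ, ∀ x, ρ₀ x ≤ C)
    -- the limits, which exist for `0 < t < t_*(u₀)`
    (ρ : ℝ → EuclideanSpace ℝ (Fin n) → ℝ)
    (ubar : ℝ → EuclideanSpace ℝ (Fin n) → EuclideanSpace ℝ (Fin n))
    (hρlim : ∀ (t : ℝ≥0) (x : EuclideanSpace ℝ (Fin n)),
      0 < t → (t : ℝ≥0∞) < StochasticBurgers.smoothTime u₀ →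
      Tendsto (fun σ : ℝ≥0 × ℝ≥0 => StochasticBurgers.massDensity
        (StochasticBurgers.jointLaw W Pr ρ₀ u₀ σ t) x) (𝓝[≠] 0) (𝓝 (ρ t x)))
    (hulim : ∀ (t : ℝ≥0) (x : EuclideanSpace ℝ (Fin n)),
      0 < t → (t : ℝ≥0∞) < StochasticBurgers.smoothTime u₀ →
      Tendsto (fun σ : ℝ≥0 × ℝ≥0 => StochasticBurgers.meanVelocity
        (StochasticBurgers.jointLaw W Pr ρ₀ u₀ σ t) x) (𝓝[≠] 0) (𝓝 (ubar t x)))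
    -- they are `C¹` and bounded on `[0, t_*(u₀)) × ℝⁿ`
    (hρ : ContDiffOn ℝ 1 (Function.uncurry ρ)
      (StochasticBurgers.slab n (StochasticBurgers.smoothTime u₀)))
    (hu : ContDiffOn ℝ 1 (Function.uncurry ubar)
      (StochasticBurgers.slab n (StochasticBurgers.smoothTime u₀)))
    (hρb : ∃ C : ℝ, ∀ p ∈ StochasticBurgers.slab n (StochasticBurgers.smoothTime u₀),
      |ρ p.1 p.2| ≤ C)
    (hub : ∃ C : ℝ, ∀ p ∈ StochasticBurgers.slab n (StochasticBurgers.smoothTime u₀),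
      ‖ubar p.1 p.2‖ ≤ C) :
    StochasticBurgers.SolvesPressurelessGas (StochasticBurgers.smoothTime u₀) ρ ubar := by
  set T := smoothTime u₀
  have hu₀c := hu₀.continuous
  have hν : ∀ t, IsBoundedTransport (massMeasure ρ₀) (freeFlow u₀ t) :=
    isBoundedTransport_massMeasure hu₀c hu₀b hρ₀b
  have hui : ∀ i, ContDiffOn ℝ 1 (Function.uncurry fun t y => ubar t y i) (slab n T) := fun i =>
    (EuclideanSpace.proj (𝕜 := ℝ) i).contDiff.comp_contDiffOn hu
  have hρu : ∀ i, ContDiffOn ℝ 1 (Function.uncurry fun t y => ρ t y * ubar t y i) (slab n T) :=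
    fun i => hρ.mul (hui i)
  have hρuu : ∀ i k, ContDiffOn ℝ 1
      (Function.uncurry fun t y => ρ t y * ubar t y i * ubar t y k) (slab n T) :=
    fun i k => (hρu i).mul (hui k)
  -- The supremum need not be attained, but each time below it is covered by some classical
  -- solution, which may depend on the time.
  have hsol : ∀ t : ℝ, ENNReal.ofReal t < T →
      ∃ T' u, IsClassicalBurgersSolution u₀ T' u ∧ ENNReal.ofReal t < T' := by
    intro t htT
    obtain ⟨T', ⟨u, hu'⟩, hlt⟩ := lt_sSup_iff.1 htT
    exact ⟨T', u, hu', hlt⟩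
  have weak : ∀ t : ℝ, 0 < t → ENNReal.ofReal t < T → ∀ φ : Sp n → ℝ, Continuous φ →
      HasCompactSupport φ →
      ∫ y, φ y * ρ t y = ∫ x, φ (freeFlow u₀ t x) ∂(massMeasure ρ₀) ∧
      ∀ i, ∫ y, φ y * (ρ t y * ubar t y i) =
        ∫ x, u₀ x i * φ (freeFlow u₀ t x) ∂(massMeasure ρ₀) := by
    intro t ht htT φ hφ hφc
    obtain ⟨T', u, hu', hlt⟩ := hsol t htT
    lift t to ℝ≥0 using ht.le
    rw [ENNReal.ofReal_coe_nnreal] at htT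
    have ht' : 0 < t := by exact_mod_cast ht
    exact integral_mul_limit hW hu₀c hu₀b ht' (hν t) (hu'.locallyBoundedImage ht.le hlt (hν t))
      (fun y => hρlim t y ht' htT) (fun y => hulim t y ht' htT) hφ hφc
  have weak2 : ∀ i k, ∀ t : ℝ, 0 < t → ENNReal.ofReal t < T → ∀ φ : Sp n → ℝ, Continuous φ →
      HasCompactSupport φ → ∫ y, φ y * (ρ t y * ubar t y i * ubar t y k) =
        ∫ x, u₀ x i * u₀ x k * φ (freeFlow u₀ t x) ∂(massMeasure ρ₀) := by
    intro i k t ht htT φ hφ hφc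
    obtain ⟨T', u, hu', hlt⟩ := hsol t htT
    have hut : Continuous (u t) := (contDiff_space hu'.smooth ht.le hlt).continuous
    have hρt : Continuous (ρ t) := (contDiff_space hρ ht.le htT).continuous
    have hubt : Continuous (ubar t) := (contDiff_space hu ht.le htT).continuous
    -- The factor `ρ` must stay: where `ρ` vanishes, `ubar` need not equal `u`.
    have hpr : ∀ i y, ρ t y * ubar t y i = ρ t y * u t y i := fun i y =>
      mul_eq_mul_of_integral hu' ht.le hlt hρt hubt
        (fun φ hφ hφc => (weak t ht htT φ hφ hφc).1) i
        (fun φ hφ hφc => (weak t ht htT φ hφ hφc).2 i) y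
    have h1 := (weak t ht htT (fun y => φ y * u t y i) (by fun_prop) hφc.mul_right).2 k
    calc ∫ y, φ y * (ρ t y * ubar t y i * ubar t y k)
        = ∫ y, φ y * u t y i * (ρ t y * ubar t y k) := by
          refine integral_congr_ae (Eventually.of_forall fun y => ?_)
          linear_combination φ y * ubar t y k * hpr i y
      _ = _ := by
          rw [h1]
          refine integral_congr_ae (Eventually.of_forall fun x => ?_)
          simp only [hu'.apply_freeFlow ht.le hlt]
          ring
  intro t x hx
  constructor
  · have h0 := balance_eq_zero hu₀c hu₀b hν (g := fun _ => 1) continuous_const hρ hρu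
      (fun t ht htT φ hφ hφc => by simpa using (weak t ht htT φ hφ hφc).1)
      (fun t ht htT k φ hφ hφc => by simpa using (weak t ht htT φ hφ hφc).2 k) hx
    rw [← balance_eq hρ hρu hx] at h0
    exact h0
  · intro i
    have h0 := balance_eq_zero hu₀c hu₀b hν (g := fun x => u₀ x i) (by fun_prop) (hρu i) (hρuu i)
      (fun t ht htT φ hφ hφc => (weak t ht htT φ hφ hφc).2 i)
      (fun t ht htT k φ hφ hφc => weak2 i k t ht htT φ hφ hφc) hx
    rw [← balance_eq (hρu i) (hρuu i) hx] at h0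
    exact h0
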